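/- Let $\mu>0$ and $\lambda+\tfrac23\mu>0$, and let $m<M<h$ and $L>0$ be real numbers. Then there is $\omega_0>0$, depending only on $\lambda,\mu,m,M,L,h$, such that the following holds. Let $U_a=\{x\in\mathbb R^3: x_3>a\}$, and let $D\subset\mathbb R^3$ be a connected open set with $U_M\subset D\subset U_m$ whose boundary is the graph $\{x_3=f(x_1,x_2)\}$ of a function $f:\mathbb R^2\to\mathbb R$ with $|f(x')-f(y')|\le L|x'-y'|$ for all $x',y'$. Put $S_h=D\setminus\overline{U_h}$, $\Gamma_h=\{x_3=h\}$, and let $V_h$ be the closure of $C_0^\infty(S_h\cup\Gamma_h)^3$ (complex-valued fields) in the $H^1(S_h)^3$ norm. For $\omega>0$ let $k_{\rm p}=\omega/\sqrt{\lambda+2\mu}$, $k_{\rm s}=\omega/\sqrt\mu$, and for $\xi\in\mathbb R^2$ let $\beta(\xi)=\sqrt{k_{\rm p}^2-|\xi|^2}$ if $|\xi|<k_{\rm p}$ and $\beta(\xi)={\rm i}\sqrt{|\xi|^2-k_{\rm p}^2}$ otherwise; define $\gamma(\xi)$ in the same way with $k_{\rm s}$ in place of $k_{\rm p}$. With $c=2\mu|\xi|^2-\omega^2+2\mu\beta\gamma$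 let $$\mathcal M(\xi)=\frac1{|\xi|^2+\beta\gamma}\begin{bmatrix}\mu[(\gamma-\beta)\xi_2^2+k_{\rm s}^2\beta] & -\mu\xi_1\xi_2(\gamma-\beta) & c\,\xi_1\\ -\mu\xi_1\xi_2(\gamma-\beta) & \mu[(\gamma-\beta)\xi_1^2+k_{\rm s}^2\beta] & c\,\xi_2\\ -c\,\xi_1 & -c\,\xi_2 & \gamma\omega^2\end{bmatrix}.$$ Write $\hat u(\xi)=\frac1{2\pi}\int_{\mathbb R^2}u(x',h)e^{-{\rm i}x'\cdot\xi}\,dx'$ (in the $L^2$ sense) for the Fourier transform of the trace of $u$ on $\Gamma_h$. The Dirichlet-to-Neumann operator $\mathcal T$ is given by $\widehat{\mathcal Tu}={\rm i}\mathcal M\hat u$, and its pairing with $v$ is $\int_{\Gamma_h}\bar v\cdot\mathcal Tu\,ds=\int_{\mathbb R^2}{\rm i}\,\mathcal M(\xi)\hat u(\xi)\cdot\overline{\hat v(\xi)}\,d\xi$. Let $$\mathcal E(u,v)=2\mu\sum_{j,k=1}^3\partial_ku_j\,\partial_kv_j+\lambda(\nabla\cdot u)(\nabla\cdot v)-\mu(\nabla\times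 u)\cdot(\nabla\times v),$$ $$B(u,v)=\int_{S_h}\big(\mathcal E(u,\bar v)-\omega^2u\cdot\bar v\big)\,dx-\int_{\Gamma_h}\bar v\cdot\mathcal Tu\,ds,\qquad u,v\in V_h.$$ Then for all $\omega\in(0,\omega_0]$ the integral defining the pairing of $\mathcal Tu$ with $v$ converges absolutely for all $u,v\in V_h$, and for every $g\in L^2(S_h)^3$ (in particular for every $g\in L^2(D)^3$ with support in $S_h$) there is exactly one $u\in V_h$ such that $$B(u,v)=-\int_{S_h}g\cdot\bar v\,dx\qquad\text{for all }v\in V_h.$$ -/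

import Mathlib

open MeasureTheory TopologicalSpace
open scoped FourierTransform Distributions ComplexConjugate

noncomputable section

namespace RoughElastic

/-- The plane `ℝ²` with its Euclidean norm. -/
abbrev R2 : Type := EuclideanSpace ℝ (Fin 2)

/-- The space `ℝ³` with its Euclidean norm. -/
abbrev R3 : Type := EuclideanSpace ℝ (Fin 3)

/-- The space `ℂ³` with its Hermitian norm. -/
abbrev C3 : Type := EuclideanSpace ℂ (Fin 3)

/-- Complex `3 × 3` matrices with the Frobenius norm; as a gradient, entry `(j, k)` is `∂ₖ uⱼ`. -/
abbrev GradMat : Type := EuclideanSpace ℂ (Fin 3 × Fin 3)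

/-- The half-space `U_a = {x ∈ ℝ³ : x₃ > a}`. -/
def upperHalf (a : ℝ) : Set R3 := {x | a < x 2}

/-- `D` is a domain lying above the graph of the `L`-Lipschitz function `f`: it is open and
connected, `U_M ⊂ D ⊂ U_m`, and its boundary is the graph of `f`. -/
structure IsRoughDomain (D : Opens R3) (f : R2 → ℝ) (m M L : ℝ) : Prop where
  connected : IsConnected (D : Set R3)
  upper_subset : upperHalf M ⊆ (D : Set R3)
  subset_upper : (D : Set R3) ⊆ upperHalf m
  boundary : frontier (D : Set R3) = {x | x 2 = f !₂[x 0, x 1]}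
  lipschitz : ∀ x y : R2, |f x - f y| ≤ L * ‖x - y‖

/-- The strip `S_h = D \ closure U_h`. -/
def strip (D : Opens R3) (h : ℝ) : Set R3 := (D : Set R3) \ closure (upperHalf h)

/-! ### The energy space -/

/-- The classical gradient (Jacobian matrix) of a vector field. -/
def gradAt (φ : R3 → C3) (x : R3) : GradMat :=
  WithLp.toLp 2 fun p => fderiv ℝ φ x (EuclideanSpace.single p.2 1) p.1

theorem continuous_gradAt {D : Opens R3} (φ : 𝓓(D, C3)) : Continuous (gradAt φ) := by
  have h1 : Continuous (fderiv ℝ φ) := φ.contDiff.continuous_fderiv (by simp)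
  unfold gradAt
  fun_prop

theorem hasCompactSupport_gradAt {D : Opens R3} (φ : 𝓓(D, C3)) : HasCompactSupport (gradAt φ) := by
  refine (φ.hasCompactSupport.fderiv (𝕜 := ℝ)).mono ?_
  intro x hx hx'
  apply hx
  ext p
  simp [gradAt, hx']

theorem memLp_test {D : Opens R3} (φ : 𝓓(D, C3)) (S : Set R3) :
    MemLp φ 2 (volume.restrict S) :=
  (φ.continuous.memLp_of_hasCompactSupport φ.hasCompactSupport).restrict S

theorem memLp_gradAt {D : Opens R3} (φ : 𝓓(D, C3)) (S : Set R3) :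
    MemLp (gradAt φ) 2 (volume.restrict S) :=
  ((continuous_gradAt φ).memLp_of_hasCompactSupport (hasCompactSupport_gradAt φ)).restrict S

/-- Pairs `(u, ∇u)` in `L²(S)³ × L²(S)^{3×3}`, with the Hilbert norm
`(‖u‖² + ‖∇u‖²)^{1/2}`, which is the `H¹` norm. -/
abbrev GradPair (S : Set R3) : Type :=
  WithLp 2 (Lp C3 2 (volume.restrict S) × Lp GradMat 2 (volume.restrict S))

theorem gradAt_add {D : Opens R3} (φ ψ : 𝓓(D, C3)) :
    gradAt (φ + ψ : 𝓓(D, C3)) = gradAt φ + gradAt ψ := by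
  funext x
  ext p
  have h1 : DifferentiableAt ℝ φ x := (φ.contDiff.differentiable (by simp)) x
  have h2 : DifferentiableAt ℝ ψ x := (ψ.contDiff.differentiable (by simp)) x
  have h3 : ((φ + ψ : 𝓓(D, C3)) : R3 → C3) = (φ : R3 → C3) + ψ := rfl
  simp [gradAt, h3, fderiv_add h1 h2]

theorem gradAt_smul {D : Opens R3} (c : ℂ) (φ : 𝓓(D, C3)) :
    gradAt (c • φ : 𝓓(D, C3)) = c • gradAt φ := by
  funext x
  ext p
  have h1 : DifferentiableAt ℝ φ x := (φ.contDiff.differentiable (by simp)) x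
  have h3 : ((c • φ : 𝓓(D, C3)) : R3 → C3) = c • (φ : R3 → C3) := rfl
  simp [gradAt, h3, fderiv_const_smul h1 c]

/-- The map `φ ↦ (φ, ∇φ)|_{S_h}` on `C_c^∞(D)³`. The restrictions of these functions to `S_h` are
the functions in `C_0^∞(S_h ∪ Γ_h)³`: smooth up to `Γ_h`, with compact support in
`S_h ∪ Γ_h = {x ∈ D : x₃ ≤ h}`, so that they vanish near `∂D` but not necessarily on `Γ_h`. -/
def testPair (D : Opens R3) (h : ℝ) : 𝓓(D, C3) →ₗ[ℂ] GradPair (strip D h) where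
  toFun φ := WithLp.toLp 2
    ((memLp_test φ (strip D h)).toLp φ, (memLp_gradAt φ (strip D h)).toLp (gradAt φ))
  map_add' φ ψ := by
    rw [← WithLp.toLp_add, Prod.mk_add_mk, ← MemLp.toLp_add, ← MemLp.toLp_add]
    simp only [gradAt_add]
    rfl
  map_smul' c φ := by
    rw [RingHom.id_apply, ← WithLp.toLp_smul, Prod.smul_mk, ← MemLp.toLp_const_smul,
      ← MemLp.toLp_const_smul]
    simp only [gradAt_smul]
    rfl

/-- The energy space `V_h`: the closure of `C_0^∞(S_h ∪ Γ_h)³` in the `H¹(S_h)` norm. An element is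
recorded as the pair `(u, ∇u)`; the second component is the weak gradient of the first and so is
determined by it. -/
def energySpace (D : Opens R3) (h : ℝ) : Submodule ℂ (GradPair (strip D h)) :=
  (LinearMap.range (testPair D h)).topologicalClosure

/-- The function `u` underlying an element of `V_h`. -/
def fn {D : Opens R3} {h : ℝ} (u : energySpace D h) : R3 → C3 := (u : GradPair (strip D h)).fst

/-- The (weak) gradient `∇u` of an element of `V_h`; entry `(j, k)` is `∂ₖ uⱼ`. -/
def grad {D : Opens R3} {h : ℝ} (u : energySpace D h) : R3 → GradMat :=
  (u : GradPair (strip D h)).snd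

/-- `C_0^∞(S_h ∪ Γ_h)³` inside `V_h`. -/
def testToEnergy (D : Opens R3) (h : ℝ) : 𝓓(D, C3) →ₗ[ℂ] energySpace D h :=
  (testPair D h).codRestrict (energySpace D h)
    fun φ => (LinearMap.range (testPair D h)).le_topologicalClosure ⟨φ, rfl⟩

/-! ### Traces on `Γ_h` and the Dirichlet-to-Neumann operator -/

/-- The parametrization `x' ↦ (x', h)` of the plane `Γ_h = {x₃ = h}`. -/
def planePoint (h : ℝ) (x : R2) : R3 := !₂[x 0, x 1, h]

theorem memLp_planeRestrict {D : Opens R3} (h : ℝ) (φ : 𝓓(D, C3)) :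
    MemLp (fun x => φ (planePoint h x)) 2 (volume : Measure R2) := by
  have hc : Continuous (planePoint h) := by unfold planePoint; fun_prop
  refine (φ.continuous.comp hc).memLp_of_hasCompactSupport ?_
  let q : R3 → R2 := fun y => !₂[y 0, y 1]
  have hq : Continuous q := by fun_prop
  refine HasCompactSupport.intro (φ.hasCompactSupport.image hq) fun x hx => ?_
  by_contra hne
  refine hx ⟨planePoint h x, subset_tsupport _ hne, ?_⟩
  ext i
  fin_cases i <;> simp [q, planePoint]

/-- Restriction of test functions to `Γ_h`, as elements of `L²(ℝ²)³`. -/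
def testTrace (D : Opens R3) (h : ℝ) : 𝓓(D, C3) →ₗ[ℂ] Lp C3 2 (volume : Measure R2) where
  toFun φ := (memLp_planeRestrict h φ).toLp _
  map_add' φ ψ := by rw [← MemLp.toLp_add]; rfl
  map_smul' c φ := by rw [RingHom.id_apply, ← MemLp.toLp_const_smul]; rfl

/-- The trace operator `u ↦ u|_{Γ_h}` on `V_h`: the continuous extension to `V_h` of the
restriction of test functions. -/
def trace (D : Opens R3) (h : ℝ) : energySpace D h →L[ℂ] Lp C3 2 (volume : Measure R2) :=
  (testTrace D h).extendOfNorm (testToEnergy D h)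

/-- The Fourier transform on `L²(ℝ²)³` with the normalization
`v̂(ξ) = (2π)⁻¹ ∫ v(x') e^{-i x'·ξ} dx'`. (Mathlib's `𝓕` has the kernel `e^{-2πi x'·ξ}`.) -/
def hat (v : Lp C3 2 (volume : Measure R2)) (ξ : R2) : C3 :=
  ((2 * Real.pi)⁻¹ : ℝ) • (𝓕 v : Lp C3 2 (volume : Measure R2)) (((2 * Real.pi)⁻¹ : ℝ) • ξ)

/-- The compressional wave number `k_p = ω / √(λ + 2μ)`. -/
def kp (lam mu ω : ℝ) : ℝ := ω / √(lam + 2 * mu)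

/-- The shear wave number `k_s = ω / √μ`. -/
def ks (mu ω : ℝ) : ℝ := ω / √mu

/-- `(k² - |ξ|²)^{1/2}` for `|ξ| < k` and `i (|ξ|² - k²)^{1/2}` for `|ξ| ≥ k`. -/
def vertical (k : ℝ) (ξ : R2) : ℂ :=
  if ‖ξ‖ < k then ((√(k ^ 2 - ‖ξ‖ ^ 2) : ℝ) : ℂ)
  else Complex.I * ((√(‖ξ‖ ^ 2 - k ^ 2) : ℝ) : ℂ)

/-- The matrix `M(ξ)` of the elastic Dirichlet-to-Neumann operator. -/
def dtnMatrix (lam mu ω : ℝ) (ξ : R2) : Matrix (Fin 3) (Fin 3) ℂ :=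
  let β : ℂ := vertical (kp lam mu ω) ξ
  let γ : ℂ := vertical (ks mu ω) ξ
  let x : ℂ := (ξ 0 : ℂ)
  let y : ℂ := (ξ 1 : ℂ)
  let r : ℂ := ((‖ξ‖ ^ 2 : ℝ) : ℂ)
  let k2 : ℂ := ((ks mu ω ^ 2 : ℝ) : ℂ)
  let c : ℂ := 2 * mu * r - ω ^ 2 + 2 * mu * β * γ
  (r + β * γ)⁻¹ •
    !![mu * ((γ - β) * y ^ 2 + k2 * β), -(mu * x * y * (γ - β)), c * x;
       -(mu * x * y * (γ - β)), mu * ((γ - β) * x ^ 2 + k2 * β), c * y;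
       -(c * x), -(c * y), γ * ω ^ 2]

/-- The Fourier transform `i M(ξ) û(ξ)` of `𝒯u`, where
`𝒯u(x') = i (2π)⁻¹ ∫ M(ξ) û(ξ) e^{i ξ·x'} dξ` and `û` is the Fourier transform of the trace of `u`
on `Γ_h`. -/
def dtnHat (lam mu ω : ℝ) {D : Opens R3} {h : ℝ} (u : energySpace D h) (ξ : R2) : Fin 3 → ℂ :=
  Complex.I • (dtnMatrix lam mu ω ξ).mulVec (hat (trace D h u) ξ).ofLp

/-- The density `conj v̂(ξ) · (𝒯u)^(ξ)` of the pairing of `𝒯u` with `v` on the Fourier side. -/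
def dtnDensity (lam mu ω : ℝ) {D : Opens R3} {h : ℝ} (u v : energySpace D h) (ξ : R2) : ℂ :=
  ∑ i, dtnHat lam mu ω u ξ i * conj (hat (trace D h v) ξ i)

/-- `∫_{Γ_h} conj v · 𝒯u ds`, that is, the duality pairing of `𝒯u ∈ H^{-1/2}(Γ_h)³` with
`v ∈ H^{1/2}(Γ_h)³`, written on the Fourier side by Parseval's identity. -/
def dtnPairing (lam mu ω : ℝ) {D : Opens R3} {h : ℝ} (u v : energySpace D h) : ℂ :=
  ∫ ξ : R2, dtnDensity lam mu ω u v ξ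

/-! ### The variational problem -/

/-- The divergence `∂₁u₁ + ∂₂u₂ + ∂₃u₃` read off from the gradient. -/
def divG (G : GradMat) : ℂ := ∑ j : Fin 3, G (j, j)

/-- The curl `(∂₂u₃ - ∂₃u₂, ∂₃u₁ - ∂₁u₃, ∂₁u₂ - ∂₂u₁)` read off from the gradient. -/
def curlG (G : GradMat) : Fin 3 → ℂ :=
  ![G (2, 1) - G (1, 2), G (0, 2) - G (2, 0), G (1, 0) - G (0, 1)]

/-- `ℰ(u, conj v) = 2μ ∑ ∂ₖuⱼ ∂ₖ(conj vⱼ) + λ (∇·u)(∇·conj v) - μ (∇×u)·(∇×conj v)`, as a function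
of the gradients `G = ∇u` and `H = ∇v`. -/
def energyDensity (lam mu : ℝ) (G H : GradMat) : ℂ :=
  2 * mu * ∑ j : Fin 3, ∑ k : Fin 3, G (j, k) * conj (H (j, k))
    + lam * (divG G * conj (divG H))
    - mu * ∑ j : Fin 3, curlG G j * conj (curlG H j)

/-- The sesquilinear form
`B(u, v) = ∫_{S_h} (ℰ(u, conj v) - ω² u · conj v) dx - ∫_{Γ_h} conj v · 𝒯u ds` on `V_h × V_h`. -/
def formB (lam mu ω : ℝ) {D : Opens R3} {h : ℝ} (u v : energySpace D h) : ℂ :=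
  (∫ x in strip D h,
      (energyDensity lam mu (grad u x) (grad v x) - ω ^ 2 * ∑ j, fn u x j * conj (fn v x j)))
    - dtnPairing lam mu ω u v

/-- `u ∈ V_h` solves the variational problem with source `g ∈ L²(S_h)³`:
`B(u, v) = -∫_{S_h} g · conj v dx` for all `v ∈ V_h`. -/
def IsVariationalSolution (lam mu ω : ℝ) {D : Opens R3} {h : ℝ}
    (g : Lp C3 2 (volume.restrict (strip D h))) (u : energySpace D h) : Prop :=
  ∀ v : energySpace D h, formB lam mu ω u v = -∫ x in strip D h, ∑ j, g x j * conj (fn v x j)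

end RoughElastic

end

noncomputable section

namespace RoughElastic

/-! ### The symbol of the Dirichlet-to-Neumann operator -/

/-! For small `ω` the form `B` is coercive on `V_h`, so Lax–Milgram gives existence and uniqueness
at once. The obstacle is that the `-μ|∇×u|²` term of the energy and the real part of the boundary
term have no good sign separately; they have to be played against each other.

The energy splits as `μ|∇u|² + (λ+μ)|∇·u|² + μN(∇u)` with `N = |∇u|² - |∇·u|² - |∇×u|²`
(`re_energyDensity_self`). The last term is a null Lagrangian. Since test functions vanish on the
bottom plane after extension by zero, its integral is a boundary term on `Γ_h`, namely the integral
of `nullForm ξ û(ξ)` (`nullLagrangian_slab`).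

The symbol is then compared with this boundary term. For `|ξ| ≥ k_s`, `β` and `γ` are imaginary and
`Re(iM a·ā) ≤ μ nullForm ξ a`, by a discriminant inequality (`symbol_quadratic_nonneg`). For `|ξ| <
k_s` both sides are `O(k_s)|a|²`, so the inequality holds up to an error `Cω|a|²`
(`re_symbolForm_le`). In `Re B(u,u)` the null-form integrals cancel, leaving `μ‖∇u‖² - ω²‖u‖² -
Cω‖u|_{Γ_h}‖²`. The Poincaré and trace inequalities on a slab of height `h - m` absorb the two
negative terms for small `ω` (`re_formB_ge`), with constants depending only on `λ`, `μ` and `h - m`.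

Boundedness rests on the symbol having order one (`norm_dtnMatrix_le`) and traces having
`|ξ|^{1/2}û` in `L²` (`integral_norm_mul_hat_trace_le`). Estimates are proved for test functions,
frequency by frequency in `ξ`, and extended by density. -/

/-- The denominator `|ξ|² + βγ` of the symbol. -/
def symbolDenom (lam mu ω : ℝ) (ξ : R2) : ℂ :=
  ((‖ξ‖ ^ 2 : ℝ) : ℂ) + vertical (kp lam mu ω) ξ * vertical (ks mu ω) ξ

/-- The sesquilinear form of the matrix `i M(ξ)`. -/
def symbolForm (lam mu ω : ℝ) (ξ : R2) (a b : C3) : ℂ :=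
  ∑ i, (Complex.I • (dtnMatrix lam mu ω ξ).mulVec a.ofLp) i * conj (b i)

/-- The boundary quadratic form of the null Lagrangian `|∇u|² - |∇·u|² - |∇×u|²` on the
Fourier side. -/
def nullForm (ξ : R2) (a : C3) : ℝ :=
  2 * ((ξ 0 * a 0 + ξ 1 * a 1) * conj (a 2)).im

theorem vertical_sq {k : ℝ} (hk : 0 ≤ k) (ξ : R2) :
    vertical k ξ ^ 2 = ((k ^ 2 - ‖ξ‖ ^ 2 : ℝ) : ℂ) := by
  unfold vertical
  split_ifs with hk'
  · rw [← Complex.ofReal_pow, Real.sq_sqrt]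
    nlinarith [norm_nonneg ξ]
  · rw [mul_pow, Complex.I_sq, ← Complex.ofReal_pow, Real.sq_sqrt]
    · push_cast
      ring
    · nlinarith [norm_nonneg ξ]

theorem norm_vertical_le {k : ℝ} (hk : 0 ≤ k) (ξ : R2) : ‖vertical k ξ‖ ≤ k + ‖ξ‖ := by
  have h : ‖vertical k ξ‖ ^ 2 = |k ^ 2 - ‖ξ‖ ^ 2| := by
    rw [← norm_pow, vertical_sq hk, Complex.norm_real, Real.norm_eq_abs]
  refine abs_le_of_sq_le_sq' ?_ (by positivity) |>.2
  rw [h, abs_le]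
  constructor <;> nlinarith [norm_nonneg ξ, mul_nonneg hk (norm_nonneg ξ)]

theorem vertical_of_lt {k : ℝ} {ξ : R2} (h : ‖ξ‖ < k) :
    vertical k ξ = ((√(k ^ 2 - ‖ξ‖ ^ 2) : ℝ) : ℂ) := if_pos h

theorem vertical_of_le {k : ℝ} {ξ : R2} (h : k ≤ ‖ξ‖) :
    vertical k ξ = Complex.I * ((√(‖ξ‖ ^ 2 - k ^ 2) : ℝ) : ℂ) := if_neg h.not_gt

/-! ### Growth and sign of the symbol. -/

section constants

variable {lam mu ω : ℝ}

theorem kp_pos (hmu : 0 < mu) (hlam : 0 < lam + mu) (hω : 0 < ω) : 0 < kp lam mu ω :=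
  div_pos hω (Real.sqrt_pos.2 (by linarith))

theorem ks_pos (hmu : 0 < mu) (hω : 0 < ω) : 0 < ks mu ω := div_pos hω (Real.sqrt_pos.2 hmu)

theorem mul_kp_sq (hmu : 0 < mu) (hlam : 0 < lam + mu) :
    (lam + 2 * mu) * kp lam mu ω ^ 2 = ω ^ 2 := by
  have : 0 < lam + 2 * mu := by linarith
  rw [kp, div_pow, Real.sq_sqrt this.le]
  field_simp

theorem mul_ks_sq (hmu : 0 < mu) : mu * ks mu ω ^ 2 = ω ^ 2 := by
  rw [ks, div_pow, Real.sq_sqrt hmu.le]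
  field_simp

theorem kp_le_ks (hmu : 0 < mu) (hlam : 0 < lam + mu) (hω : 0 < ω) :
    kp lam mu ω ≤ ks mu ω :=
  div_le_div_of_nonneg_left hω.le (Real.sqrt_pos.2 hmu) (Real.sqrt_le_sqrt (by linarith))

/-- The symbol has no poles. Below `k_p`, `γ ≥ β ≥ 0` gives `|ξ|² + βγ ≥ |ξ|² + β² = k_p²`. Between
the wave numbers `βγ` is imaginary, so the real part is `|ξ|² ≥ k_p²`. Above `k_s`, the
arithmetic–geometric mean inequality gives at least `(k_p² + k_s²)/2`. -/
theorem kp_sq_le_norm_symbolDenom (hmu : 0 < mu) (hlam : 0 < lam + mu) (hω : 0 < ω) (ξ : R2) :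
    kp lam mu ω ^ 2 ≤ ‖symbolDenom lam mu ω ξ‖ := by
  have hp := kp_pos hmu hlam hω
  have hps := kp_le_ks hmu hlam hω
  unfold symbolDenom
  set k := kp lam mu ω
  set K := ks mu ω
  rcases lt_or_ge ‖ξ‖ k with h | h
  · have h' : ‖ξ‖ < K := h.trans_le hps
    rw [vertical_of_lt h, vertical_of_lt h', ← Complex.ofReal_mul, ← Complex.ofReal_add,
      Complex.norm_real]
    refine le_trans ?_ (le_abs_self _)
    have h1 : √(k ^ 2 - ‖ξ‖ ^ 2) ≤ √(K ^ 2 - ‖ξ‖ ^ 2) :=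
      Real.sqrt_le_sqrt (by nlinarith)
    have h2 : √(k ^ 2 - ‖ξ‖ ^ 2) ^ 2 = k ^ 2 - ‖ξ‖ ^ 2 :=
      Real.sq_sqrt (by nlinarith [norm_nonneg ξ])
    nlinarith [Real.sqrt_nonneg (k ^ 2 - ‖ξ‖ ^ 2)]
  rcases lt_or_ge ‖ξ‖ K with h' | h'
  · rw [vertical_of_le h, vertical_of_lt h']
    refine le_trans ?_ (Complex.abs_re_le_norm _)
    refine le_trans ?_ (le_abs_self _)
    simp only [Complex.add_re, Complex.ofReal_re, Complex.mul_re, Complex.I_re, Complex.ofReal_im,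
      Complex.I_im, Complex.mul_im]
    nlinarith
  · rw [vertical_of_le h, vertical_of_le h']
    refine le_trans ?_ (Complex.abs_re_le_norm _)
    refine le_trans ?_ (le_abs_self _)
    have h2 : √(‖ξ‖ ^ 2 - k ^ 2) ^ 2 = ‖ξ‖ ^ 2 - k ^ 2 := Real.sq_sqrt (by nlinarith)
    have h3 : √(‖ξ‖ ^ 2 - K ^ 2) ^ 2 = ‖ξ‖ ^ 2 - K ^ 2 := Real.sq_sqrt (by nlinarith)
    have e : (((‖ξ‖ ^ 2 : ℝ) : ℂ) + Complex.I * ((√(‖ξ‖ ^ 2 - k ^ 2) : ℝ) : ℂ) *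
        (Complex.I * ((√(‖ξ‖ ^ 2 - K ^ 2) : ℝ) : ℂ))) =
        ((‖ξ‖ ^ 2 - √(‖ξ‖ ^ 2 - k ^ 2) * √(‖ξ‖ ^ 2 - K ^ 2) : ℝ) : ℂ) := by
      push_cast
      linear_combination (√(‖ξ‖ ^ 2 - k ^ 2) * √(‖ξ‖ ^ 2 - K ^ 2) : ℂ) * Complex.I_sq
    rw [e, Complex.ofReal_re]
    nlinarith [sq_nonneg (√(‖ξ‖ ^ 2 - k ^ 2) - √(‖ξ‖ ^ 2 - K ^ 2))]

theorem norm_sq_R2 (ξ : R2) : ‖ξ‖ ^ 2 = ξ 0 ^ 2 + ξ 1 ^ 2 := by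
  simp [EuclideanSpace.norm_sq_eq]

/-- The constant in the growth bound of the symbol. -/
def symbolConst (lam mu : ℝ) : ℝ := 2 * mu + 2 * (lam + 2 * mu)

theorem norm_matrix_three_apply_le {a b c d e f g h k : ℂ} {B : ℝ} (ha : ‖a‖ ≤ B) (hb : ‖b‖ ≤ B)
    (hc : ‖c‖ ≤ B) (hd : ‖d‖ ≤ B) (he : ‖e‖ ≤ B) (hf : ‖f‖ ≤ B) (hg : ‖g‖ ≤ B) (hh : ‖h‖ ≤ B)
    (hk : ‖k‖ ≤ B) (i j : Fin 3) : ‖!![a, b, c; d, e, f; g, h, k] i j‖ ≤ B := by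
  fin_cases i <;> fin_cases j <;> assumption

/-- The denominator `ρ` is only known to exceed `k_p²`, so each numerator is bounded by a multiple
of `‖ρ‖` instead: `ω² = (λ+2μ)k_p² ≤ (λ+2μ)‖ρ‖`, and the terms that look quadratic in `ξ` are
rewritten through `ρ`. The resulting constant does not depend on `ω`. -/
theorem norm_dtnMatrix_le (hmu : 0 < mu) (hlam : 0 < lam + mu) (hω : 0 < ω) (ξ : R2)
    (i j : Fin 3) :
    ‖dtnMatrix lam mu ω ξ i j‖ ≤ symbolConst lam mu * (ks mu ω + ‖ξ‖) := by
  have hp := kp_pos hmu hlam hω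
  have hs := ks_pos hmu hω
  have hps := kp_le_ks hmu hlam hω
  have hkp := mul_kp_sq (ω := ω) hmu hlam
  have hks := mul_ks_sq (ω := ω) hmu
  have hden := kp_sq_le_norm_symbolDenom hmu hlam hω ξ
  have hβ : ‖vertical (kp lam mu ω) ξ‖ ≤ ks mu ω + ‖ξ‖ :=
    (norm_vertical_le hp.le ξ).trans (by gcongr)
  have hγ := norm_vertical_le hs.le ξ
  have hγ2 := vertical_sq hs.le ξ
  have hβ2 := vertical_sq hp.le ξ
  have hr := norm_sq_R2 ξ
  set β := vertical (kp lam mu ω) ξ with hβdef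
  set γ := vertical (ks mu ω) ξ with hγdef
  set k := kp lam mu ω with hkdef
  set K := ks mu ω with hKdef
  set T := K + ‖ξ‖ with hT
  set ρ := symbolDenom lam mu ω ξ with hρdef
  have hρ : ρ = ((‖ξ‖ ^ 2 : ℝ) : ℂ) + β * γ := rfl
  have hN : 0 < ‖ρ‖ := (by positivity : 0 < k ^ 2).trans_le hden
  have hT0 : 0 < T := by positivity
  have hl : 0 < lam + 2 * mu := by linarith
  have hωρ : ω ^ 2 ≤ (lam + 2 * mu) * ‖ρ‖ := by rw [← hkp]; gcongr
  have F2 : mu * (K ^ 2 * ‖β‖) ≤ (lam + 2 * mu) * T * ‖ρ‖ := by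
    calc mu * (K ^ 2 * ‖β‖) = ω ^ 2 * ‖β‖ := by rw [← hks]; ring
      _ ≤ ((lam + 2 * mu) * ‖ρ‖) * T := by gcongr
      _ = _ := by ring
  have F1 : mu * (‖γ - β‖ * ‖ξ‖ ^ 2) ≤ (mu * T + (lam + 2 * mu) * T) * ‖ρ‖ := by
    -- This identity, from `γ² = K² - |ξ|²`, trades the factor `|ξ|²` for `ρ` plus a term of size
    -- `K²`.
    have e : (γ - β) * ((‖ξ‖ ^ 2 : ℝ) : ℂ) = γ * ρ - ((K ^ 2 : ℝ) : ℂ) * β := by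
      rw [hρ]
      have : γ ^ 2 = ((K ^ 2 : ℝ) : ℂ) - ((‖ξ‖ ^ 2 : ℝ) : ℂ) := by rw [hγ2]; push_cast; ring
      linear_combination -β * this
    have e' : ‖γ - β‖ * ‖ξ‖ ^ 2 ≤ ‖γ‖ * ‖ρ‖ + K ^ 2 * ‖β‖ := by
      have := congrArg norm e
      rw [norm_mul, Complex.norm_real, Real.norm_of_nonneg (by positivity)] at this
      rw [this]
      refine (norm_sub_le _ _).trans_eq ?_
      rw [norm_mul, norm_mul, Complex.norm_real, Real.norm_of_nonneg (by positivity)]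
    calc mu * (‖γ - β‖ * ‖ξ‖ ^ 2) ≤ mu * (‖γ‖ * ‖ρ‖ + K ^ 2 * ‖β‖) := by gcongr
      _ = mu * ‖γ‖ * ‖ρ‖ + mu * (K ^ 2 * ‖β‖) := by ring
      _ ≤ mu * T * ‖ρ‖ + (lam + 2 * mu) * T * ‖ρ‖ := by gcongr
      _ = _ := by ring
  have F3 : ‖2 * mu * ((‖ξ‖ ^ 2 : ℝ) : ℂ) - ω ^ 2 + 2 * mu * β * γ‖ ≤
      (2 * mu + (lam + 2 * mu)) * ‖ρ‖ := by
    have e : 2 * mu * ((‖ξ‖ ^ 2 : ℝ) : ℂ) - ω ^ 2 + 2 * mu * β * γ =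
        ((2 * mu : ℝ) : ℂ) * ρ - ((ω ^ 2 : ℝ) : ℂ) := by rw [hρ]; push_cast; ring
    rw [e]
    refine (norm_sub_le _ _).trans ?_
    rw [norm_mul, Complex.norm_real, Complex.norm_real, Real.norm_of_nonneg (by positivity),
      Real.norm_of_nonneg (by positivity), add_mul]
    gcongr
  have F4 : ‖γ‖ * ω ^ 2 ≤ (lam + 2 * mu) * T * ‖ρ‖ := by
    calc ‖γ‖ * ω ^ 2 ≤ T * ((lam + 2 * mu) * ‖ρ‖) := by gcongr
      _ = _ := by ring
  have hx : |ξ 0| ≤ T := by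
    have : |ξ 0| ≤ ‖ξ‖ := abs_le_of_sq_le_sq (by nlinarith) (norm_nonneg _)
    linarith
  have hy : |ξ 1| ≤ T := by
    have : |ξ 1| ≤ ‖ξ‖ := abs_le_of_sq_le_sq (by nlinarith) (norm_nonneg _)
    linarith
  have hxx : |ξ 0| * |ξ 0| ≤ ‖ξ‖ ^ 2 := by
    rw [abs_mul_abs_self]; nlinarith
  have hyy : |ξ 1| * |ξ 1| ≤ ‖ξ‖ ^ 2 := by
    rw [abs_mul_abs_self]; nlinarith
  have hxy : |ξ 0| * |ξ 1| ≤ ‖ξ‖ ^ 2 := by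
    nlinarith [sq_nonneg (|ξ 0| - |ξ 1|), sq_abs (ξ 0), sq_abs (ξ 1)]
  have hconst : symbolConst lam mu = 2 * mu + 2 * (lam + 2 * mu) := rfl
  have hmuT : 0 ≤ mu * T * ‖ρ‖ := by positivity
  have hlT : 0 ≤ (lam + 2 * mu) * T * ‖ρ‖ := by positivity
  have key : ∀ w : ℂ, ‖w‖ ≤ symbolConst lam mu * T * ‖ρ‖ →
      ‖ρ⁻¹ * w‖ ≤ symbolConst lam mu * T := by
    intro w hw
    rw [norm_mul, norm_inv, inv_mul_le_iff₀ hN]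
    linarith
  have hdiag : ∀ s : ℝ, |s| * |s| ≤ ‖ξ‖ ^ 2 →
      ‖mu * ((γ - β) * (s : ℂ) ^ 2 + ((K ^ 2 : ℝ) : ℂ) * β)‖ ≤ symbolConst lam mu * T * ‖ρ‖ := by
    intro s hs'
    rw [norm_mul, Complex.norm_real, Real.norm_of_nonneg hmu.le]
    calc mu * ‖(γ - β) * (s : ℂ) ^ 2 + ((K ^ 2 : ℝ) : ℂ) * β‖
        ≤ mu * (‖γ - β‖ * ‖ξ‖ ^ 2 + K ^ 2 * ‖β‖) := by
          gcongr
          refine (norm_add_le _ _).trans ?_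
          rw [norm_mul, norm_mul, norm_pow, Complex.norm_real, Complex.norm_real,
            Real.norm_eq_abs, Real.norm_of_nonneg (by positivity : 0 ≤ K ^ 2), pow_two |s|]
          gcongr
      _ ≤ symbolConst lam mu * T * ‖ρ‖ := by rw [hconst]; linarith
  have hoff : ‖-(mu * (ξ 0 : ℂ) * (ξ 1 : ℂ) * (γ - β))‖ ≤ symbolConst lam mu * T * ‖ρ‖ := by
    rw [norm_neg, norm_mul, norm_mul, norm_mul, Complex.norm_real, Complex.norm_real,
      Complex.norm_real, Real.norm_of_nonneg hmu.le, Real.norm_eq_abs, Real.norm_eq_abs]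
    calc mu * |ξ 0| * |ξ 1| * ‖γ - β‖ = mu * (‖γ - β‖ * (|ξ 0| * |ξ 1|)) := by ring
      _ ≤ mu * (‖γ - β‖ * ‖ξ‖ ^ 2) := by gcongr
      _ ≤ symbolConst lam mu * T * ‖ρ‖ := by rw [hconst]; linarith
  have hc : ∀ s : ℝ, |s| ≤ T →
      ‖(2 * mu * ((‖ξ‖ ^ 2 : ℝ) : ℂ) - ω ^ 2 + 2 * mu * β * γ) * (s : ℂ)‖ ≤
        symbolConst lam mu * T * ‖ρ‖ := by
    intro s hs'
    rw [norm_mul, Complex.norm_real, Real.norm_eq_abs]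
    calc _ ≤ ((2 * mu + (lam + 2 * mu)) * ‖ρ‖) * T := by gcongr
      _ ≤ symbolConst lam mu * T * ‖ρ‖ := by rw [hconst]; linarith
  have hzz : ‖γ * (ω : ℂ) ^ 2‖ ≤ symbolConst lam mu * T * ‖ρ‖ := by
    rw [norm_mul, norm_pow, Complex.norm_real, Real.norm_of_nonneg hω.le, hconst]
    linarith
  rw [dtnMatrix]
  simp only [← hβdef, ← hγdef, ← hkdef, ← hKdef, ← hρ, Matrix.smul_apply, smul_eq_mul]
  refine key _ (norm_matrix_three_apply_le (hdiag _ hyy) hoff (hc _ hx) hoff (hdiag _ hxx)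
    (hc _ hy) ?_ ?_ hzz i j)
  · rw [norm_neg]; exact hc _ hx
  · rw [norm_neg]; exact hc _ hy

theorem norm_symbolForm_le (hmu : 0 < mu) (hlam : 0 < lam + mu) (hω : 0 < ω) (ξ : R2)
    (a b : C3) :
    ‖symbolForm lam mu ω ξ a b‖ ≤ 9 * symbolConst lam mu * (ks mu ω + ‖ξ‖) * (‖a‖ * ‖b‖) := by
  have hC : 0 ≤ symbolConst lam mu * (ks mu ω + ‖ξ‖) :=
    (norm_nonneg _).trans (norm_dtnMatrix_le hmu hlam hω ξ 0 0)
  have h1 : ∀ i, ‖(Complex.I • (dtnMatrix lam mu ω ξ).mulVec a.ofLp) i‖ ≤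
      3 * (symbolConst lam mu * (ks mu ω + ‖ξ‖) * ‖a‖) := by
    intro i
    rw [Pi.smul_apply, norm_smul, Complex.norm_I, one_mul, Matrix.mulVec, dotProduct]
    refine (norm_sum_le _ _).trans ?_
    refine (Finset.sum_le_sum (g := fun _ => symbolConst lam mu * (ks mu ω + ‖ξ‖) * ‖a‖)
      fun j _ => ?_).trans (by simp)
    rw [norm_mul]
    exact mul_le_mul (norm_dtnMatrix_le hmu hlam hω ξ i j) (PiLp.norm_apply_le a j)
      (norm_nonneg _) hC
  refine (norm_sum_le _ _).trans ?_
  refine (Finset.sum_le_sum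
    (g := fun _ => 3 * (symbolConst lam mu * (ks mu ω + ‖ξ‖) * ‖a‖) * ‖b‖)
      fun j _ => ?_).trans (by simp; linarith)
  rw [norm_mul, RCLike.norm_conj]
  exact mul_le_mul (h1 j) (PiLp.norm_apply_le b j) (norm_nonneg _) (by positivity)

theorem abs_nullForm_le (ξ : R2) (a : C3) : |nullForm ξ a| ≤ 4 * ‖ξ‖ * ‖a‖ ^ 2 := by
  have hx : |ξ 0| ≤ ‖ξ‖ := abs_le_of_sq_le_sq (by nlinarith [norm_sq_R2 ξ]) (norm_nonneg _)
  have hy : |ξ 1| ≤ ‖ξ‖ := abs_le_of_sq_le_sq (by nlinarith [norm_sq_R2 ξ]) (norm_nonneg _)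
  rw [nullForm, abs_mul, abs_two]
  calc 2 * |((ξ 0 * a 0 + ξ 1 * a 1) * conj (a 2)).im|
      ≤ 2 * ‖(ξ 0 * a 0 + ξ 1 * a 1) * conj (a 2)‖ := by gcongr; exact Complex.abs_im_le_norm _
    _ ≤ 2 * ((‖ξ‖ * ‖a‖ + ‖ξ‖ * ‖a‖) * ‖a‖) := by
      rw [norm_mul, RCLike.norm_conj]
      gcongr
      · refine (norm_add_le _ _).trans ?_
        rw [norm_mul, norm_mul, Complex.norm_real, Complex.norm_real, Real.norm_eq_abs,
          Real.norm_eq_abs]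
        gcongr
        · exact PiLp.norm_apply_le a 0
        · exact PiLp.norm_apply_le a 1
      · exact PiLp.norm_apply_le a 2
    _ = _ := by ring

/-- The discriminant inequality behind the positivity of the symbol at high frequencies. -/
theorem discriminant_le {b g r : ℝ} (hg : 0 ≤ g) (hgb : g ≤ b) (hbr : b ^ 2 ≤ r) :
    r * g * (b - g) ^ 2 ≤ (r - g ^ 2) ^ 2 * b := by
  -- In the variables `x = b - g` and `k = r - g²` the hypothesis `b² ≤ r` reads `x² + 2gx ≤ k`.
  -- Using it twice yields `k² ≥ x²(g² + k)`.
  obtain ⟨x, rfl⟩ : ∃ x, b = g + x := ⟨b - g, by ring⟩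
  obtain ⟨k, rfl⟩ : ∃ k, r = g ^ 2 + k := ⟨r - g ^ 2, by ring⟩
  have hx0 : 0 ≤ x := by linarith
  have hk0 : x ^ 2 + 2 * g * x ≤ k := by linarith
  have hgx : 0 ≤ g * x := by positivity
  have hkk : 0 ≤ k := by nlinarith
  have h1 : x ^ 2 * (g ^ 2 + k) ≤ k ^ 2 := by
    nlinarith [mul_le_mul_of_nonneg_left hk0 hkk, mul_le_mul_of_nonneg_left hk0 hgx,
      mul_nonneg hgx (sq_nonneg x)]
  calc (g ^ 2 + k) * g * (g + x - g) ^ 2 = g * (x ^ 2 * (g ^ 2 + k)) := by ring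
    _ ≤ g * k ^ 2 := by gcongr
    _ ≤ (g + x) * k ^ 2 := by gcongr
    _ = (g ^ 2 + k - g ^ 2) ^ 2 * (g + x) := by ring

theorem quadratic_nonneg {A B C p q t : ℝ} (hA : 0 ≤ A) (hB : 0 ≤ B) (hC : C ^ 2 ≤ A * B)
    (ht : |t| ≤ p * q) : 0 ≤ A * p ^ 2 + B * q ^ 2 + 2 * (C * t) := by
  have h1 : |C * t| ≤ √A * √B * (p * q) := by
    rw [abs_mul]
    gcongr
    rw [← Real.sqrt_mul hA]
    exact Real.abs_le_sqrt hC
  have h2 := neg_abs_le (C * t)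
  nlinarith [sq_nonneg (√A * p - √B * q), Real.sq_sqrt hA, Real.sq_sqrt hB]

/-- The algebraic form of the positivity of the symbol at high frequencies. -/
theorem symbol_quadratic_nonneg {b g x y : ℝ} (hg : 0 ≤ g) (hgb : g ≤ b)
    (hbr : b ^ 2 ≤ x ^ 2 + y ^ 2) (hr : 0 < x ^ 2 + y ^ 2) (a₀ a₁ a₂ : ℂ) :
    0 ≤ (g - b) * ‖y * a₀ - x * a₁‖ ^ 2 +
      (x ^ 2 + y ^ 2 - g ^ 2) * b * (‖a₀‖ ^ 2 + ‖a₁‖ ^ 2) +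
      (x ^ 2 + y ^ 2 - g ^ 2) * g * ‖a₂‖ ^ 2 +
      2 * (g * (b - g) * ((x * a₀ + y * a₁) * conj a₂).im) := by
  have hb : 0 ≤ b := hg.trans hgb
  have hgr : g ^ 2 ≤ x ^ 2 + y ^ 2 := le_trans (by gcongr) hbr
  have hgbr : g * b ≤ x ^ 2 + y ^ 2 := le_trans (by nlinarith) hbr
  have hK : 0 ≤ x ^ 2 + y ^ 2 - g ^ 2 := by linarith
  -- Lagrange's identity: the horizontal part of the vector is split along and across `ξ`.
  have hsum : (x ^ 2 + y ^ 2) * (‖a₀‖ ^ 2 + ‖a₁‖ ^ 2) =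
      ‖x * a₀ + y * a₁‖ ^ 2 + ‖y * a₀ - x * a₁‖ ^ 2 := by
    simp only [← Complex.normSq_eq_norm_sq, Complex.normSq_apply, Complex.add_re, Complex.add_im,
      Complex.sub_re, Complex.sub_im, Complex.re_ofReal_mul, Complex.im_ofReal_mul]
    ring
  have him : |((x * a₀ + y * a₁) * conj a₂).im| ≤ ‖x * a₀ + y * a₁‖ * ‖a₂‖ := by
    refine (Complex.abs_im_le_norm _).trans_eq ?_
    rw [norm_mul, RCLike.norm_conj]
  generalize ((x * a₀ + y * a₁) * conj a₂).im = t at *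
  generalize ‖y * a₀ - x * a₁‖ = w at *
  have hd := discriminant_le hg hgb hbr
  have hq := quadratic_nonneg (A := (x ^ 2 + y ^ 2 - g ^ 2) * b)
    (B := (x ^ 2 + y ^ 2) * (x ^ 2 + y ^ 2 - g ^ 2) * g)
    (C := (x ^ 2 + y ^ 2) * (g * (b - g))) (by positivity) (by positivity) (by
      have : 0 ≤ (x ^ 2 + y ^ 2) * g := by positivity
      nlinarith [mul_le_mul_of_nonneg_left hd this]) him
  -- Multiplied by `|ξ|²`, the expression decouples into a quadratic form in the longitudinal and
  -- vertical components, with the discriminant just bounded, and `g(|ξ|² - gb)w²` for the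
  -- transverse component.
  refine nonneg_of_mul_nonneg_right (a := x ^ 2 + y ^ 2) ?_ hr
  have hw : 0 ≤ g * (x ^ 2 + y ^ 2 - g * b) * w ^ 2 :=
    mul_nonneg (mul_nonneg hg (by linarith)) (sq_nonneg w)
  linear_combination hq + hw - (x ^ 2 + y ^ 2 - g ^ 2) * b * hsum

/-- Here `β = ib` and `γ = ig` with `0 ≤ g ≤ b`. The difference of the two sides is `μ/(|ξ|² - bg)`
times the expression in `symbol_quadratic_nonneg`. -/
theorem re_symbolForm_le_of_ks_le (hmu : 0 < mu) (hlam : 0 < lam + mu) (hω : 0 < ω) {ξ : R2}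
    (hξ : ks mu ω ≤ ‖ξ‖) (a : C3) :
    (symbolForm lam mu ω ξ a a).re ≤ mu * nullForm ξ a := by
  have hp := kp_pos hmu hlam hω
  have hs := ks_pos hmu hω
  have hps := kp_le_ks hmu hlam hω
  have hks := mul_ks_sq (ω := ω) hmu
  have hr := norm_sq_R2 ξ
  have hden := kp_sq_le_norm_symbolDenom hmu hlam hω ξ
  unfold symbolDenom at hden
  simp only [symbolForm, dtnMatrix, nullForm]
  rw [vertical_of_le hξ, vertical_of_le (hps.trans hξ)] at hden ⊢
  have hb2 := Real.sq_sqrt (show 0 ≤ ‖ξ‖ ^ 2 - kp lam mu ω ^ 2 by nlinarith)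
  have hg2 := Real.sq_sqrt (show 0 ≤ ‖ξ‖ ^ 2 - ks mu ω ^ 2 by nlinarith)
  have hgb : √(‖ξ‖ ^ 2 - ks mu ω ^ 2) ≤ √(‖ξ‖ ^ 2 - kp lam mu ω ^ 2) :=
    Real.sqrt_le_sqrt (by nlinarith)
  have hg0 := Real.sqrt_nonneg (‖ξ‖ ^ 2 - ks mu ω ^ 2)
  set k := kp lam mu ω
  set K := ks mu ω
  set b := √(‖ξ‖ ^ 2 - k ^ 2)
  set g := √(‖ξ‖ ^ 2 - K ^ 2)
  have hK : K ^ 2 = ξ 0 ^ 2 + ξ 1 ^ 2 - g ^ 2 := by rw [hg2, hr]; ring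
  rw [hr] at *
  have hbr : b ^ 2 ≤ ξ 0 ^ 2 + ξ 1 ^ 2 := by rw [hb2]; nlinarith
  have hKpos : 0 < K ^ 2 := by positivity
  have hr0 : 0 < ξ 0 ^ 2 + ξ 1 ^ 2 := by nlinarith [sq_nonneg g]
  have hq := symbol_quadratic_nonneg hg0 hgb hbr hr0 (a 0) (a 1) (a 2)
  have hR0 : 0 < ξ 0 ^ 2 + ξ 1 ^ 2 - b * g := by nlinarith
  have e1 : (((ξ 0 ^ 2 + ξ 1 ^ 2 : ℝ) : ℂ) + Complex.I * (b : ℂ) * (Complex.I * (g : ℂ))) =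
      ((ξ 0 ^ 2 + ξ 1 ^ 2 - b * g : ℝ) : ℂ) := by
    push_cast
    linear_combination (b * g : ℂ) * Complex.I_sq
  have e2 : 2 * (mu : ℂ) * ((ξ 0 ^ 2 + ξ 1 ^ 2 : ℝ) : ℂ) - (ω : ℂ) ^ 2 +
      2 * mu * (Complex.I * b) * (Complex.I * g) =
      ((mu * (ξ 0 ^ 2 + ξ 1 ^ 2 - 2 * b * g + g ^ 2) : ℝ) : ℂ) := by
    rw [← Complex.ofReal_pow, ← hks, hK]
    push_cast
    linear_combination (2 * mu * b * g : ℂ) * Complex.I_sq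
  have e3 : (ω : ℂ) ^ 2 = ((mu * (ξ 0 ^ 2 + ξ 1 ^ 2 - g ^ 2) : ℝ) : ℂ) := by
    rw [← hK, hks, Complex.ofReal_pow]
  rw [e1, e2, e3, hK]
  set R := ξ 0 ^ 2 + ξ 1 ^ 2 - b * g with hR
  have hexp : mu * (2 * ((ξ 0 * a 0 + ξ 1 * a 1) * conj (a 2)).im) -
      (∑ i, (Complex.I • ((R : ℂ)⁻¹ •
        !![mu * ((Complex.I * g - Complex.I * b) * (ξ 1 : ℂ) ^ 2 +
            ((ξ 0 ^ 2 + ξ 1 ^ 2 - g ^ 2 : ℝ) : ℂ) * (Complex.I * b)),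
          -(mu * (ξ 0 : ℂ) * (ξ 1 : ℂ) * (Complex.I * g - Complex.I * b)),
          ((mu * (ξ 0 ^ 2 + ξ 1 ^ 2 - 2 * b * g + g ^ 2) : ℝ) : ℂ) * (ξ 0 : ℂ);
          -(mu * (ξ 0 : ℂ) * (ξ 1 : ℂ) * (Complex.I * g - Complex.I * b)),
          mu * ((Complex.I * g - Complex.I * b) * (ξ 0 : ℂ) ^ 2 +
            ((ξ 0 ^ 2 + ξ 1 ^ 2 - g ^ 2 : ℝ) : ℂ) * (Complex.I * b)),
          ((mu * (ξ 0 ^ 2 + ξ 1 ^ 2 - 2 * b * g + g ^ 2) : ℝ) : ℂ) * (ξ 1 : ℂ);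
          -(((mu * (ξ 0 ^ 2 + ξ 1 ^ 2 - 2 * b * g + g ^ 2) : ℝ) : ℂ) * (ξ 0 : ℂ)),
          -(((mu * (ξ 0 ^ 2 + ξ 1 ^ 2 - 2 * b * g + g ^ 2) : ℝ) : ℂ) * (ξ 1 : ℂ)),
          Complex.I * g * ((mu * (ξ 0 ^ 2 + ξ 1 ^ 2 - g ^ 2) : ℝ) : ℂ)]).mulVec a.ofLp) i *
          conj (a i)).re =
      mu / R * ((g - b) * ‖ξ 1 * a 0 - ξ 0 * a 1‖ ^ 2 +
      (ξ 0 ^ 2 + ξ 1 ^ 2 - g ^ 2) * b * (‖a 0‖ ^ 2 + ‖a 1‖ ^ 2) +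
      (ξ 0 ^ 2 + ξ 1 ^ 2 - g ^ 2) * g * ‖a 2‖ ^ 2 +
      2 * (g * (b - g) * ((ξ 0 * a 0 + ξ 1 * a 1) * conj (a 2)).im)) := by
    -- Inserting `R⁻¹R` in the null form makes every term carry the factor `R⁻¹`. Once that factor
    -- is an arbitrary number, the claim is a polynomial identity.
    have hI : (2 : ℝ) * ((ξ 0 * a 0 + ξ 1 * a 1) * conj (a 2)).im = R⁻¹ *
        (2 * (R * ((ξ 0 * a 0 + ξ 1 * a 1) * conj (a 2)).im)) := by
      field_simp
    rw [hI, div_eq_mul_inv, ← Complex.ofReal_inv]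
    generalize R⁻¹ = S
    rw [hR]
    simp only [Matrix.mulVec, dotProduct, Fin.sum_univ_three, Matrix.smul_apply, Pi.smul_apply,
      Matrix.of_apply, Matrix.cons_val', Matrix.cons_val_zero, Matrix.cons_val_one,
      Matrix.cons_val, Matrix.cons_val_fin_one, smul_eq_mul, Complex.sq_norm,
      Complex.normSq_apply, Complex.add_re, Complex.add_im, Complex.sub_re, Complex.sub_im,
      Complex.mul_re, Complex.mul_im, Complex.I_re, Complex.I_im, Complex.ofReal_re,
      Complex.ofReal_im, Complex.conj_re, Complex.conj_im, Complex.neg_re, Complex.neg_im]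
    simp only [pow_two, Complex.mul_re, Complex.mul_im, Complex.ofReal_re, Complex.ofReal_im]
    ring
  rw [← sub_nonneg, hexp]
  positivity

/-- The constant in the low-frequency bound of the symbol. -/
def lowFreqConst (lam mu : ℝ) : ℝ := (18 * symbolConst lam mu + 4 * mu) / √mu

/-- No error is needed above `k_s`. Below it, `k_s + |ξ| ≤ 2k_s` bounds both forms by a multiple of
`k_s = ω/√μ`; this is where the `18 = 2·9` and the `4μ` in the constant come from. -/
theorem re_symbolForm_le (hmu : 0 < mu) (hlam : 0 < lam + mu) (hω : 0 < ω) (ξ : R2) (a : C3) :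
    (symbolForm lam mu ω ξ a a).re ≤
      mu * nullForm ξ a + lowFreqConst lam mu * ω * ‖a‖ ^ 2 := by
  have hs := ks_pos hmu hω
  have hC : 0 ≤ symbolConst lam mu := by unfold symbolConst; linarith
  have hK : lowFreqConst lam mu * ω = (18 * symbolConst lam mu + 4 * mu) * ks mu ω := by
    rw [lowFreqConst, ks]; ring
  rw [hK]
  rcases le_or_gt (ks mu ω) ‖ξ‖ with h | h
  · have := re_symbolForm_le_of_ks_le hmu hlam hω h a
    have h2 : 0 ≤ (18 * symbolConst lam mu + 4 * mu) * ks mu ω * ‖a‖ ^ 2 := by positivity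
    linarith
  · have h1 := (Complex.re_le_norm _).trans (norm_symbolForm_le hmu hlam hω ξ a a)
    have h2 := (abs_le.1 (abs_nullForm_le ξ a)).1
    have h3 : 9 * symbolConst lam mu * (ks mu ω + ‖ξ‖) * (‖a‖ * ‖a‖) ≤
        9 * symbolConst lam mu * (ks mu ω + ks mu ω) * (‖a‖ * ‖a‖) := by gcongr
    have h4 : 4 * ‖ξ‖ * ‖a‖ ^ 2 ≤ 4 * ks mu ω * ‖a‖ ^ 2 := by gcongr
    nlinarith

end constants

/-! ### The null Lagrangian and vertical integrals -/

/-- The null Lagrangian `|∇u|² - |∇·u|² - |∇×u|²` as a function of the gradient. -/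
def nullLagrangian (G : GradMat) : ℝ :=
  ‖G‖ ^ 2 - ‖divG G‖ ^ 2 - ∑ j, ‖curlG G j‖ ^ 2

/-- The gradient on the Fourier side: horizontal derivatives act as multiplication by `i ξ`. -/
def symbolGrad (ξ : R2) (a b : C3) : GradMat :=
  WithLp.toLp 2 fun p =>
    (![Complex.I * ξ 0 * a p.1, Complex.I * ξ 1 * a p.1, b p.1] : Fin 3 → ℂ) p.2

/-- One of the two copies of `μ|∇u|²` is spent on completing the null Lagrangian; the other supplies
the coercivity, without Korn's inequality. -/
theorem re_energyDensity_self (lam mu : ℝ) (G : GradMat) :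
    (energyDensity lam mu G G).re =
      mu * ‖G‖ ^ 2 + (lam + mu) * ‖divG G‖ ^ 2 + mu * nullLagrangian G := by
  have h : energyDensity lam mu G G = ((2 * mu * ‖G‖ ^ 2 + lam * ‖divG G‖ ^ 2 -
      mu * ∑ j, ‖curlG G j‖ ^ 2 : ℝ) : ℂ) := by
    rw [EuclideanSpace.norm_sq_eq, Fintype.sum_prod_type, energyDensity]
    simp only [Complex.mul_conj, Complex.normSq_eq_norm_sq]
    push_cast
    rfl
  rw [h, Complex.ofReal_re, nullLagrangian]
  ring

theorem norm_sq_symbolGrad (ξ : R2) (a b : C3) :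
    ‖symbolGrad ξ a b‖ ^ 2 = ‖ξ‖ ^ 2 * ‖a‖ ^ 2 + ‖b‖ ^ 2 := by
  simp only [EuclideanSpace.norm_sq_eq, Fintype.sum_prod_type, Fin.sum_univ_three,
    Fin.sum_univ_two, symbolGrad, Matrix.cons_val_zero, Matrix.cons_val_one, Matrix.cons_val,
    norm_mul, Complex.norm_I, Complex.norm_real, Real.norm_eq_abs, one_mul, mul_pow, sq_abs]
  ring

/-- All terms quadratic in `a` alone or in `b` alone cancel. The surviving cross terms are an exact
derivative of `nullForm` when `b` is the vertical derivative of `a`. -/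
theorem nullLagrangian_symbolGrad (ξ : R2) (a b : C3) :
    nullLagrangian (symbolGrad ξ a b) =
      2 * ((ξ 0 * b 0 + ξ 1 * b 1) * conj (a 2) + (ξ 0 * a 0 + ξ 1 * a 1) * conj (b 2)).im := by
  simp only [nullLagrangian, EuclideanSpace.norm_sq_eq, Fintype.sum_prod_type, Fin.sum_univ_three,
    symbolGrad, divG, curlG, Matrix.cons_val_zero, Matrix.cons_val_one, Matrix.cons_val,
    Complex.sq_norm, Complex.normSq_apply, Complex.add_re, Complex.add_im, Complex.sub_re,
    Complex.sub_im, Complex.mul_re, Complex.mul_im, Complex.I_re, Complex.I_im,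
    Complex.ofReal_re, Complex.ofReal_im, Complex.conj_re, Complex.conj_im]
  ring

/-! ### One-dimensional identities and inequalities at a fixed frequency. -/

section vertical

variable {m h : ℝ} {U V : ℝ → C3}

theorem hasDerivAt_nullForm (ξ : R2) {t : ℝ} (hU : HasDerivAt U (V t) t) :
    HasDerivAt (fun t => nullForm ξ (U t)) (nullLagrangian (symbolGrad ξ (U t) (V t))) t := by
  have hc : ∀ i, HasDerivAt (fun t => U t i) (V t i) t := fun i =>
    ((EuclideanSpace.proj (𝕜 := ℂ) i : C3 →L[ℂ] ℂ).restrictScalars ℝ).hasFDerivAt.comp_hasDerivAt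
      t hU
  have hstar : HasDerivAt (fun t => conj (U t 2)) (conj (V t 2)) t :=
    (Complex.conjCLE : ℂ →L[ℝ] ℂ).hasFDerivAt.comp_hasDerivAt t (hc 2)
  have h1 := ((((hc 0).const_mul (ξ 0 : ℂ)).add ((hc 1).const_mul (ξ 1 : ℂ))).mul hstar)
  have h2 := ((Complex.imCLM).hasFDerivAt.comp_hasDerivAt t h1).const_mul 2
  rw [nullLagrangian_symbolGrad]
  exact h2

theorem integral_nullLagrangian_symbolGrad (ξ : R2) (hV : Continuous V)
    (hU : ∀ t, HasDerivAt U (V t) t) (hm : U m = 0) :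
    ∫ t in m..h, nullLagrangian (symbolGrad ξ (U t) (V t)) = nullForm ξ (U h) := by
  have hUc : Continuous U := continuous_iff_continuousAt.2 fun t => (hU t).continuousAt
  rw [intervalIntegral.integral_eq_sub_of_hasDerivAt fun t _ => hasDerivAt_nullForm ξ (hU t)]
  · simp [hm, nullForm]
  · refine Continuous.intervalIntegrable ?_ _ _
    simp only [nullLagrangian_symbolGrad]
    have := Complex.continuous_conj
    fun_prop

/-- The left side is the integral of `(s‖U‖²)' = 2s Re⟨U,V⟩`, and `2s Re⟨U,V⟩ ≤ s²‖U‖² + ‖V‖²`. With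
`s = ‖ξ‖` the integrand is the squared norm of the Fourier-side gradient, so this is the `H^{1/2}`
trace estimate. -/
theorem mul_norm_sq_le_integral (hmh : m ≤ h) {s : ℝ} (hV : Continuous V)
    (hU : ∀ t, HasDerivAt U (V t) t) (hm : U m = 0) :
    s * ‖U h‖ ^ 2 ≤ ∫ t in m..h, (s ^ 2 * ‖U t‖ ^ 2 + ‖V t‖ ^ 2) := by
  have hUc : Continuous U := continuous_iff_continuousAt.2 fun t => (hU t).continuousAt
  have hd : ∀ t, HasDerivAt (fun t => s * ‖U t‖ ^ 2) (s * (2 * (inner ℂ (U t) (V t)).re)) t := by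
    intro t
    let _ : InnerProductSpace ℝ C3 := InnerProductSpace.rclikeToReal ℂ C3
    exact (hU t).norm_sq.const_mul s
  have hFTC := intervalIntegral.integral_eq_sub_of_hasDerivAt (a := m) (b := h)
    (fun t _ => hd t) (Continuous.intervalIntegrable (by fun_prop) _ _)
  have : s * ‖U h‖ ^ 2 = ∫ t in m..h, s * (2 * (inner ℂ (U t) (V t)).re) := by
    rw [hFTC, hm]; simp
  rw [this]
  refine intervalIntegral.integral_mono_on hmh (Continuous.intervalIntegrable (by fun_prop) _ _)
    (Continuous.intervalIntegrable (by fun_prop) _ _) fun t _ => ?_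
  have h1 : |(inner ℂ (U t) (V t)).re| ≤ ‖U t‖ * ‖V t‖ :=
    (Complex.abs_re_le_norm _).trans (norm_inner_le_norm _ _)
  have h2 : s * (inner ℂ (U t) (V t)).re ≤ |s| * (‖U t‖ * ‖V t‖) :=
    (le_abs_self _).trans (by rw [abs_mul]; gcongr)
  nlinarith [sq_nonneg (|s| * ‖U t‖ - ‖V t‖), sq_abs s]

/-- Cauchy–Schwarz, read off from the nonnegativity of the variance of `f`. -/
theorem sq_integral_le {f : ℝ → ℝ} (hf : Continuous f) (hmh : m ≤ h) :
    (∫ t in m..h, f t) ^ 2 ≤ (h - m) * ∫ t in m..h, f t ^ 2 := by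
  rcases hmh.eq_or_lt with rfl | hlt
  · simp
  set J := ∫ t in m..h, f t with hJ
  have h0 : 0 ≤ ∫ t in m..h, (f t - J / (h - m)) ^ 2 :=
    intervalIntegral.integral_nonneg hmh fun t _ => sq_nonneg _
  have e : ∫ t in m..h, (f t - J / (h - m)) ^ 2 =
      (∫ t in m..h, f t ^ 2) - 2 * (J / (h - m)) * J + (h - m) * (J / (h - m)) ^ 2 := by
    have : ∀ t, (f t - J / (h - m)) ^ 2 =
        f t ^ 2 - 2 * (J / (h - m)) * f t + (J / (h - m)) ^ 2 := fun t => by ring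
    simp only [this]
    rw [intervalIntegral.integral_add, intervalIntegral.integral_sub,
      intervalIntegral.integral_const_mul, intervalIntegral.integral_const, smul_eq_mul]
    all_goals exact Continuous.intervalIntegrable (by fun_prop) _ _
  have hpos : 0 < h - m := by linarith
  rw [e] at h0
  have e2 : (h - m) * ((∫ t in m..h, f t ^ 2) - 2 * (J / (h - m)) * J +
      (h - m) * (J / (h - m)) ^ 2) = (h - m) * (∫ t in m..h, f t ^ 2) - J ^ 2 := by
    field_simp
    ring
  nlinarith [mul_nonneg hpos.le h0]

theorem norm_sq_le_integral {t : ℝ} (hmt : m ≤ t) (hth : t ≤ h) (hV : Continuous V)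
    (hU : ∀ t, HasDerivAt U (V t) t) (hm : U m = 0) :
    ‖U t‖ ^ 2 ≤ (h - m) * ∫ s in m..h, ‖V s‖ ^ 2 := by
  have e : U t = ∫ s in m..t, V s := by
    rw [intervalIntegral.integral_eq_sub_of_hasDerivAt (fun s _ => hU s)
      (hV.intervalIntegrable _ _), hm, sub_zero]
  have h1 : ‖U t‖ ≤ ∫ s in m..t, ‖V s‖ := by
    rw [e]; exact intervalIntegral.norm_integral_le_integral_norm hmt
  have hmono : ∫ s in m..t, ‖V s‖ ^ 2 ≤ ∫ s in m..h, ‖V s‖ ^ 2 :=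
    intervalIntegral.integral_mono_interval le_rfl hmt hth
      (Filter.Eventually.of_forall fun s => sq_nonneg _)
      (Continuous.intervalIntegrable (by fun_prop) _ _)
  have hnn : 0 ≤ ∫ s in m..t, ‖V s‖ ^ 2 :=
    intervalIntegral.integral_nonneg hmt fun s _ => sq_nonneg _
  calc ‖U t‖ ^ 2 ≤ (∫ s in m..t, ‖V s‖) ^ 2 := by gcongr
    _ ≤ (t - m) * ∫ s in m..t, ‖V s‖ ^ 2 := sq_integral_le hV.norm hmt
    _ ≤ (h - m) * ∫ s in m..h, ‖V s‖ ^ 2 := by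
      apply mul_le_mul _ hmono hnn <;> linarith

end vertical

/-! ### Horizontal slices and the planar Fourier transform -/

section slices

variable {E : Type*} [NormedAddCommGroup E]

/-- The slice `x' ↦ F (x', t)`. -/
def slice (F : R3 → E) (t : ℝ) (x : R2) : E := F (planePoint t x)

/-- The horizontal projection `x ↦ x'`. -/
def horizontal (y : R3) : R2 := !₂[y 0, y 1]

theorem continuous_horizontal : Continuous horizontal := by unfold horizontal; fun_prop

@[simp] theorem horizontal_planePoint (t : ℝ) (x : R2) : horizontal (planePoint t x) = x := by
  ext i
  fin_cases i <;> simp [horizontal, planePoint]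

@[simp] theorem planePoint_two (t : ℝ) (x : R2) : planePoint t x 2 = t := by
  simp [planePoint]

theorem continuous_planePoint : Continuous fun p : ℝ × R2 => planePoint p.1 p.2 := by
  unfold planePoint; fun_prop

/-- One compact set contains the supports of all slices. Integrals over slices become integrals over
a fixed compact set, where continuity and differentiation in `t` are available. -/
theorem slice_eq_zero_of_notMem {F : R3 → E} (t : ℝ) {x : R2}
    (hx : x ∉ horizontal '' tsupport F) : slice F t x = 0 := by
  by_contra hne
  exact hx ⟨planePoint t x, subset_tsupport _ hne, horizontal_planePoint t x⟩

theorem isCompact_horizontal_image {F : R3 → E} (hF : HasCompactSupport F) :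
    IsCompact (horizontal '' tsupport F) := hF.image continuous_horizontal

theorem hasCompactSupport_slice {F : R3 → E} (hF : HasCompactSupport F) (t : ℝ) :
    HasCompactSupport (slice F t) :=
  HasCompactSupport.intro (isCompact_horizontal_image hF) fun _ => slice_eq_zero_of_notMem t

theorem continuous_slice_uncurry {F : R3 → E} (hF : Continuous F) :
    Continuous fun p : ℝ × R2 => slice F p.1 p.2 := hF.comp continuous_planePoint

theorem continuous_slice {F : R3 → E} (hF : Continuous F) (t : ℝ) : Continuous (slice F t) :=
  (continuous_slice_uncurry hF).comp (by fun_prop : Continuous fun x : R2 => (t, x))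

theorem planePoint_eq_toLp_insertNth (t : ℝ) (x : R2) :
    planePoint t x = WithLp.toLp 2
      ((MeasurableEquiv.piFinSuccAbove (fun _ : Fin 3 => ℝ) 2).symm (t, x.ofLp)) := by
  ext i
  fin_cases i
  · rfl
  · rfl
  · simp [planePoint]

/-- Coordinates `(t, x') ↦ (x', t)` preserve Lebesgue measure. -/
theorem measurePreserving_planePoint :
    MeasurePreserving (fun p : ℝ × R2 => planePoint p.1 p.2) := by
  have h1 : MeasurePreserving (Prod.map (id : ℝ → ℝ) (WithLp.ofLp : R2 → Fin 2 → ℝ)) :=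
    (MeasurePreserving.id volume).prod (PiLp.volume_preserving_ofLp (Fin 2))
  have h2 := (volume_preserving_piFinSuccAbove (fun _ : Fin 3 => ℝ) 2).symm
  have h3 := PiLp.volume_preserving_toLp (Fin 3)
  have := (h3.comp h2).comp h1
  convert this using 1
  funext p
  exact planePoint_eq_toLp_insertNth p.1 p.2

theorem measurableEmbedding_planePoint :
    MeasurableEmbedding (fun p : ℝ × R2 => planePoint p.1 p.2) := by
  refine continuous_planePoint.measurableEmbedding fun p q hpq => ?_
  have h1 := congrArg horizontal hpq
  have h2 := congrArg (fun y : R3 => y 2) hpq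
  simp only [horizontal_planePoint, planePoint_two] at h1 h2
  exact Prod.ext h2 h1

theorem setIntegral_slab [NormedSpace ℝ E] {F : R3 → E} (hF : Continuous F)
    (hF' : HasCompactSupport F) (a b : ℝ) :
    ∫ x in {x : R3 | a < x 2 ∧ x 2 < b}, F x = ∫ t in Set.Ioo a b, ∫ x, slice F t x := by
  have hint : Integrable F := hF.integrable_of_hasCompactSupport hF'
  have hint' : Integrable (fun p : ℝ × R2 => slice F p.1 p.2) (volume.prod volume) :=
    measurePreserving_planePoint.integrable_comp_of_integrable hint
  have hpre : (fun p : ℝ × R2 => planePoint p.1 p.2) ⁻¹' {x : R3 | a < x 2 ∧ x 2 < b} =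
      Set.Ioo a b ×ˢ Set.univ := by
    ext p; simp
  rw [← measurePreserving_planePoint.setIntegral_preimage_emb measurableEmbedding_planePoint,
    hpre]
  change ∫ p in Set.Ioo a b ×ˢ Set.univ, slice F p.1 p.2 ∂(volume.prod volume) = _
  rw [setIntegral_prod _ hint'.integrableOn]
  simp only [Measure.restrict_univ]

theorem continuous_integral_slice [NormedSpace ℝ E] {F : R3 → E} (hF : Continuous F)
    (hF' : HasCompactSupport F) : Continuous fun t => ∫ x, slice F t x := by
  have h : ∀ t, ∫ x, slice F t x = ∫ x in horizontal '' tsupport F, slice F t x := fun t =>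
    (setIntegral_eq_integral_of_forall_compl_eq_zero fun x => slice_eq_zero_of_notMem t).symm
  simp only [h]
  exact continuous_parametric_integral_of_continuous (continuous_slice_uncurry hF)
    (isCompact_horizontal_image hF')

/-- The directional derivative `∂ₖ F`. -/
def partialDeriv [NormedSpace ℝ E] (k : Fin 3) (F : R3 → E) (x : R3) : E :=
  fderiv ℝ F x (EuclideanSpace.single k 1)

variable [NormedSpace ℝ E]

theorem hasCompactSupport_partialDeriv {F : R3 → E} (hF : HasCompactSupport F) (k : Fin 3) :
    HasCompactSupport (partialDeriv k F) := hF.fderiv_apply ℝ _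

theorem continuous_partialDeriv {F : R3 → E} (hF : ContDiff ℝ 1 F) (k : Fin 3) :
    Continuous (partialDeriv k F) :=
  (hF.continuous_fderiv one_ne_zero).clm_apply continuous_const

theorem hasDerivAt_slice {F : R3 → E} (hF : ContDiff ℝ 1 F) (x : R2) (t : ℝ) :
    HasDerivAt (fun t => slice F t x) (slice (partialDeriv 2 F) t x) t := by
  have h1 : HasDerivAt (fun t => planePoint t x) (EuclideanSpace.single (2 : Fin 3) (1 : ℝ)) t := by
    have e : (fun t => planePoint t x) =
        fun t => planePoint 0 x + t • EuclideanSpace.single (2 : Fin 3) (1 : ℝ) := by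
      funext t
      ext i
      fin_cases i <;> simp [planePoint]
    rw [e]
    simpa using ((hasDerivAt_id t).smul_const (EuclideanSpace.single (2 : Fin 3) (1 : ℝ))).const_add
      (planePoint 0 x)
  exact ((hF.differentiable one_ne_zero) _).hasFDerivAt.comp_hasDerivAt t h1

/-- The linear inclusion `x' ↦ (x', 0)`. -/
def planeIncl : R2 →L[ℝ] R3 :=
  LinearMap.toContinuousLinearMap
    { toFun := fun x => !₂[x 0, x 1, 0]
      map_add' := fun x y => by ext i; fin_cases i <;> simp
      map_smul' := fun c x => by ext i; fin_cases i <;> simp }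

theorem planePoint_eq_planeIncl_add (t : ℝ) (x : R2) :
    planePoint t x = planeIncl x + EuclideanSpace.single 2 t := by
  ext i
  fin_cases i <;> simp [planePoint, planeIncl]

theorem hasFDerivAt_slice {F : R3 → E} (hF : ContDiff ℝ 1 F) (t : ℝ) (x : R2) :
    HasFDerivAt (slice F t) ((fderiv ℝ F (planePoint t x)).comp planeIncl) x := by
  have h1 : HasFDerivAt (planePoint t) planeIncl x := by
    have : planePoint t = fun x => planeIncl x + EuclideanSpace.single 2 t :=
      funext (planePoint_eq_planeIncl_add t)
    rw [this]
    exact planeIncl.hasFDerivAt.add_const _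
  exact ((hF.differentiable one_ne_zero) _).hasFDerivAt.comp x h1

theorem contDiff_slice {n : WithTop ℕ∞} {F : R3 → E} (hF : ContDiff ℝ n F) (t : ℝ) :
    ContDiff ℝ n (slice F t) := by
  refine hF.comp (?_ : ContDiff ℝ n (planePoint t))
  have : planePoint t = fun x => planeIncl x + EuclideanSpace.single 2 t :=
    funext (planePoint_eq_planeIncl_add t)
  rw [this]
  exact planeIncl.contDiff.add contDiff_const

end slices

/-! ### Plancherel's identity for slices and slabs. -/

section planarFourier

variable {E : Type*} [NormedAddCommGroup E] [NormedSpace ℂ E]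

/-- The Fourier transform `(2π)⁻¹ ∫ f(x') e^{-i x'·ξ} dx'` on the plane. -/
def planarFourier (f : R2 → E) (ξ : R2) : E :=
  ((2 * Real.pi)⁻¹ : ℝ) • 𝓕 f (((2 * Real.pi)⁻¹ : ℝ) • ξ)

theorem planarFourier_eq (f : R2 → E) (ξ : R2) :
    planarFourier f ξ = ((2 * Real.pi)⁻¹ : ℝ) •
      ∫ x, Complex.exp (((-inner ℝ x ξ : ℝ) : ℂ) * Complex.I) • f x := by
  rw [planarFourier, Real.fourier_eq']
  congr 2
  funext x
  congr 3
  rw [inner_smul_right]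
  field_simp

theorem norm_exp_smul (s : ℝ) (v : E) : ‖Complex.exp ((s : ℂ) * Complex.I) • v‖ = ‖v‖ := by
  rw [norm_smul, Complex.norm_exp_ofReal_mul_I, one_mul]

theorem planarFourier_slice_eq {F : R3 → E} (t : ℝ) (ξ : R2) :
    planarFourier (slice F t) ξ = ((2 * Real.pi)⁻¹ : ℝ) • ∫ x in horizontal '' tsupport F,
      Complex.exp (((-inner ℝ x ξ : ℝ) : ℂ) * Complex.I) • slice F t x := by
  rw [planarFourier_eq, setIntegral_eq_integral_of_forall_compl_eq_zero]
  intro x hx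
  rw [slice_eq_zero_of_notMem t hx, smul_zero]

theorem continuous_planarFourier_slice {F : R3 → E} (hF : Continuous F)
    (hF' : HasCompactSupport F) :
    Continuous fun p : ℝ × R2 => planarFourier (slice F p.1) p.2 := by
  simp only [planarFourier_slice_eq]
  refine Continuous.const_smul (continuous_parametric_integral_of_continuous
    (f := fun (p : ℝ × R2) x => Complex.exp (((-inner ℝ x p.2 : ℝ) : ℂ) * Complex.I) •
      slice F p.1 x) ?_ (isCompact_horizontal_image hF')) _
  have h1 : Continuous fun q : (ℝ × R2) × R2 => slice F q.1.1 q.2 :=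
    (continuous_slice_uncurry hF).comp (by fun_prop : Continuous fun q : (ℝ × R2) × R2 =>
      (q.1.1, q.2))
  change Continuous fun q : (ℝ × R2) × R2 =>
    Complex.exp (((-inner ℝ q.2 q.1.2 : ℝ) : ℂ) * Complex.I) • slice F q.1.1 q.2
  fun_prop

theorem continuous_planarFourier_slice_left {F : R3 → E} (hF : Continuous F)
    (hF' : HasCompactSupport F) (ξ : R2) : Continuous fun t => planarFourier (slice F t) ξ := by
  simpa only [Function.comp_def] using
    (continuous_planarFourier_slice hF hF').comp (Continuous.prodMk_left ξ)

theorem continuous_planarFourier_slice_right {F : R3 → E} (hF : Continuous F)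
    (hF' : HasCompactSupport F) (t : ℝ) : Continuous fun ξ => planarFourier (slice F t) ξ := by
  simpa only [Function.comp_def] using
    (continuous_planarFourier_slice hF hF').comp (Continuous.prodMk_right t)

theorem hasDerivAt_planarFourier_slice {F : R3 → E} (hF : ContDiff ℝ 1 F)
    (hF' : HasCompactSupport F) (ξ : R2) (t : ℝ) :
    HasDerivAt (fun t => planarFourier (slice F t) ξ)
      (planarFourier (slice (partialDeriv 2 F) t) ξ) t := by
  obtain ⟨C, hC⟩ := (continuous_partialDeriv hF 2).bounded_above_of_compact_support
    (hasCompactSupport_partialDeriv hF' 2)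
  have hK := isCompact_horizontal_image hF'
  have hcont : ∀ G : R3 → E, Continuous G → ∀ t, Continuous fun x : R2 =>
      Complex.exp (((-inner ℝ x ξ : ℝ) : ℂ) * Complex.I) • slice G t x := by
    intro G hG t
    have := continuous_slice hG t
    fun_prop
  have hsub : ∀ x ∉ horizontal '' tsupport F, slice (partialDeriv 2 F) t x = 0 := by
    intro x hx
    refine slice_eq_zero_of_notMem t fun hx' => hx ?_
    exact Set.image_mono (tsupport_fderiv_apply_subset ℝ _) hx'
  have e : planarFourier (slice (partialDeriv 2 F) t) ξ =
      ((2 * Real.pi)⁻¹ : ℝ) • ∫ x in horizontal '' tsupport F,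
        Complex.exp (((-inner ℝ x ξ : ℝ) : ℂ) * Complex.I) • slice (partialDeriv 2 F) t x := by
    rw [planarFourier_eq, setIntegral_eq_integral_of_forall_compl_eq_zero]
    intro x hx
    rw [hsub x hx, smul_zero]
  rw [e]
  simp only [planarFourier_slice_eq]
  refine HasDerivAt.const_smul _ (hasDerivAt_integral_of_dominated_loc_of_deriv_le
    (F := fun t x => Complex.exp (((-inner ℝ x ξ : ℝ) : ℂ) * Complex.I) • slice F t x)
    (bound := fun _ => C) (F' := fun t x =>
      Complex.exp (((-inner ℝ x ξ : ℝ) : ℂ) * Complex.I) • slice (partialDeriv 2 F) t x)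
    (s := Set.univ) Filter.univ_mem
    (Filter.Eventually.of_forall fun t => (hcont F hF.continuous t).aestronglyMeasurable)
    ((hcont F hF.continuous t).continuousOn.integrableOn_compact hK)
    (hcont _ (continuous_partialDeriv hF 2) t).aestronglyMeasurable
    (Filter.Eventually.of_forall fun x t _ => ?_)
    (integrableOn_const hK.measure_ne_top)
    (Filter.Eventually.of_forall fun x t _ => ?_)).2
  · rw [norm_exp_smul]
    exact hC _
  · exact (hasDerivAt_slice hF x t).const_smul _

theorem planarFourier_clm {E' : Type*} [NormedAddCommGroup E'] [NormedSpace ℂ E']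
    [CompleteSpace E] [CompleteSpace E'] (T : E →L[ℂ] E') {f : R2 → E} (hf : Integrable f)
    (ξ : R2) : planarFourier (fun x => T (f x)) ξ = T (planarFourier f ξ) := by
  have hint : Integrable fun x => Complex.exp (((-inner ℝ x ξ : ℝ) : ℂ) * Complex.I) • f x := by
    refine hf.norm.mono' (AEStronglyMeasurable.smul ?_ hf.1)
      (Filter.Eventually.of_forall fun x => (norm_exp_smul _ _).le)
    exact Continuous.aestronglyMeasurable (by fun_prop)
  rw [planarFourier_eq, planarFourier_eq, ← Complex.coe_smul, ← Complex.coe_smul, map_smul,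
    ← T.integral_comp_comm hint]
  simp only [map_smul]

theorem planarFourier_slice_partialDeriv [CompleteSpace E] {F : R3 → E} (hF : ContDiff ℝ 1 F)
    (hF' : HasCompactSupport F) (t : ℝ) (ξ : R2) (k : Fin 2) :
    planarFourier (slice (partialDeriv k.castSucc F) t) ξ =
      (Complex.I * ξ k) • planarFourier (slice F t) ξ := by
  have hd := contDiff_slice hF t
  have hs := hasCompactSupport_slice hF' t
  have hi : Integrable (slice F t) := hd.continuous.integrable_of_hasCompactSupport hs
  have hi' : Integrable (fderiv ℝ (slice F t)) :=
    (hd.continuous_fderiv one_ne_zero).integrable_of_hasCompactSupport (hs.fderiv (𝕜 := ℝ))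
  have e : slice (partialDeriv k.castSucc F) t =
      fun x => fderiv ℝ (slice F t) x (EuclideanSpace.single k 1) := by
    funext x
    rw [(hasFDerivAt_slice hF t x).fderiv]
    have : planeIncl (EuclideanSpace.single k 1) = EuclideanSpace.single k.castSucc 1 := by
      ext i
      fin_cases k <;> fin_cases i <;> simp [planeIncl]
    rw [ContinuousLinearMap.comp_apply, this]
    rfl
  have h := congrFun (Real.fourier_fderiv hi (hd.differentiable one_ne_zero) hi')
    (((2 * Real.pi)⁻¹ : ℝ) • ξ)
  have h2 := Real.fourier_continuousLinearMap_apply (a := EuclideanSpace.single k 1)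
    (v := ((2 * Real.pi)⁻¹ : ℝ) • ξ) hi'
  rw [planarFourier, e, planarFourier, ← h2, h]
  have hin : (-innerSL ℝ) (((2 * Real.pi)⁻¹ : ℝ) • ξ) (EuclideanSpace.single k (1 : ℝ)) =
      -((2 * Real.pi)⁻¹ * ξ k) := by
    rw [neg_apply, neg_apply, innerSL_apply_apply,
      inner_smul_left, EuclideanSpace.inner_single_right]
    simp
  rw [VectorFourier.fourierSMulRight_apply, hin]
  simp only [← Complex.coe_smul, smul_smul]
  congr 1
  have hpi : (Real.pi : ℂ) ≠ 0 := by exact_mod_cast Real.pi_ne_zero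
  push_cast
  field_simp

variable {H : Type*} [NormedAddCommGroup H] [InnerProductSpace ℂ H] [CompleteSpace H]

/-- The normalization is unitary in dimension two: the factor `(2π)⁻²` from squaring cancels the
Jacobian `(2π)²` of the dilation. -/
theorem plancherel_planarFourier {f : R2 → H} (hf : ContDiff ℝ (⊤ : ℕ∞) f)
    (hf' : HasCompactSupport f) :
    Integrable (fun ξ => ‖planarFourier f ξ‖ ^ 2) ∧
      ∫ ξ, ‖planarFourier f ξ‖ ^ 2 = ∫ x, ‖f x‖ ^ 2 := by
  set g := hf'.toSchwartzMap hf
  have hF : ∀ η, 𝓕 f η = (𝓕 g) η := fun η => rfl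
  have hc : (0 : ℝ) < (2 * Real.pi)⁻¹ := by positivity
  have e : ∀ ξ, ‖planarFourier f ξ‖ ^ 2 =
      ((2 * Real.pi)⁻¹) ^ 2 * ‖(𝓕 g) (((2 * Real.pi)⁻¹ : ℝ) • ξ)‖ ^ 2 := by
    intro ξ
    rw [planarFourier, norm_smul, mul_pow, Real.norm_of_nonneg hc.le, hF]
  have hint : Integrable fun η => ‖(𝓕 g) η‖ ^ 2 :=
    ((𝓕 g).memLp 2 volume).integrable_norm_pow two_ne_zero
  simp only [e]
  refine ⟨(hint.comp_smul hc.ne').const_mul _, ?_⟩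
  have hk := Measure.integral_comp_smul volume
    (fun η => ‖(𝓕 g : SchwartzMap R2 H) η‖ ^ 2) (2 * Real.pi)⁻¹
  rw [integral_const_mul, hk,
    SchwartzMap.integral_norm_sq_fourier, finrank_euclideanSpace_fin, smul_eq_mul, abs_of_pos
    (by positivity), ← mul_assoc, mul_inv_cancel₀ (by positivity), one_mul]
  rfl

theorem plancherel_slab {F : R3 → H} (hF : ContDiff ℝ (⊤ : ℕ∞) F) (hF' : HasCompactSupport F)
    (a b : ℝ) :
    Integrable (fun p : ℝ × R2 => ‖planarFourier (slice F p.1) p.2‖ ^ 2)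
        ((volume.restrict (Set.Ioo a b)).prod volume) ∧
      ∫ p, ‖planarFourier (slice F p.1) p.2‖ ^ 2 ∂((volume.restrict (Set.Ioo a b)).prod volume) =
        ∫ x in {x : R3 | a < x 2 ∧ x 2 < b}, ‖F x‖ ^ 2 := by
  have hP := fun t => plancherel_planarFourier (contDiff_slice hF t) (hasCompactSupport_slice hF' t)
  have hN : Continuous fun x => ‖F x‖ ^ 2 := hF.continuous.norm.pow 2
  have hN' : HasCompactSupport fun x => ‖F x‖ ^ 2 :=
    hF'.comp_left (g := fun v => ‖v‖ ^ 2) (by simp)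
  have hint : Integrable (fun p : ℝ × R2 => ‖planarFourier (slice F p.1) p.2‖ ^ 2)
      ((volume.restrict (Set.Ioo a b)).prod volume) := by
    refine (integrable_prod_iff
      ((continuous_planarFourier_slice hF.continuous hF').norm.pow 2).aestronglyMeasurable).2 ?_
    refine ⟨Filter.Eventually.of_forall fun t => (hP t).1, ?_⟩
    have e : ∀ t, ∫ ξ, ‖‖planarFourier (slice F t) ξ‖ ^ 2‖ =
        ∫ x, slice (fun x => ‖F x‖ ^ 2) t x := by
      intro t
      simp only [Real.norm_of_nonneg (sq_nonneg _)]
      exact (hP t).2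
    exact (((continuous_integral_slice hN hN').integrableOn_Icc (a := a) (b := b)).mono_set
      Set.Ioo_subset_Icc_self).congr (Filter.Eventually.of_forall fun t => (e t).symm)
  refine ⟨hint, ?_⟩
  rw [setIntegral_slab hN hN', integral_prod _ hint]
  exact integral_congr_ae (Filter.Eventually.of_forall fun t => (hP t).2)

end planarFourier

/-! ### Estimates for test functions -/

attribute [irreducible] planarFourier

/-- The divergence as a continuous linear functional of the gradient. -/
def divCLM : GradMat →L[ℂ] ℂ := ∑ j : Fin 3, EuclideanSpace.proj (j, j)

/-- The curl components as continuous linear functionals of the gradient. -/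
def curlCLM (j : Fin 3) : GradMat →L[ℂ] ℂ :=
  (![EuclideanSpace.proj (2, 1) - EuclideanSpace.proj (1, 2),
    EuclideanSpace.proj (0, 2) - EuclideanSpace.proj (2, 0),
    EuclideanSpace.proj (1, 0) - EuclideanSpace.proj (0, 1)] : Fin 3 → GradMat →L[ℂ] ℂ) j

theorem divCLM_apply (G : GradMat) : divCLM G = divG G := by
  simp [divCLM, divG, Fin.sum_univ_three]

theorem curlCLM_apply (j : Fin 3) (G : GradMat) : curlCLM j G = curlG G j := by
  fin_cases j <;> simp [curlCLM, curlG]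

section testFunctions

variable {φ : R3 → C3}

theorem contDiff_gradAt (hφ : ContDiff ℝ (⊤ : ℕ∞) φ) : ContDiff ℝ (⊤ : ℕ∞) (gradAt φ) := by
  have h1 : ContDiff ℝ (⊤ : ℕ∞) (fderiv ℝ φ) := hφ.fderiv_right le_rfl
  refine (contDiff_piLp 2).2 fun p => ?_
  have h2 : ContDiff ℝ (⊤ : ℕ∞) fun x => fderiv ℝ φ x (EuclideanSpace.single p.2 1) :=
    h1.clm_apply contDiff_const
  exact ((EuclideanSpace.proj (𝕜 := ℂ) p.1 : C3 →L[ℂ] ℂ).restrictScalars ℝ).contDiff.comp h2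

theorem hasCompactSupport_gradAt_of_hasCompactSupport (hφ : HasCompactSupport φ) : HasCompactSupport (gradAt φ) := by
  refine (hφ.fderiv (𝕜 := ℝ)).mono fun x hx hx' => hx ?_
  ext p
  simp [gradAt, hx']

theorem planarFourier_slice_gradAt (hφ : ContDiff ℝ (⊤ : ℕ∞) φ) (hφ' : HasCompactSupport φ)
    (t : ℝ) (ξ : R2) :
    planarFourier (slice (gradAt φ) t) ξ = symbolGrad ξ (planarFourier (slice φ t) ξ)
      (planarFourier (slice (partialDeriv 2 φ) t) ξ) := by
  have h1 : ContDiff ℝ 1 φ := hφ.of_le (by exact_mod_cast le_top)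
  have hi : Integrable (slice (gradAt φ) t) :=
    (continuous_slice (contDiff_gradAt hφ).continuous t).integrable_of_hasCompactSupport
      (hasCompactSupport_slice (hasCompactSupport_gradAt_of_hasCompactSupport hφ') t)
  have hk : ∀ k, Integrable (slice (partialDeriv k φ) t) := fun k =>
    (continuous_slice (continuous_partialDeriv h1 k) t).integrable_of_hasCompactSupport
      (hasCompactSupport_slice (hasCompactSupport_partialDeriv hφ' k) t)
  ext ⟨j, k⟩
  have e : planarFourier (slice (gradAt φ) t) ξ (j, k) =
      planarFourier (slice (partialDeriv k φ) t) ξ j :=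
    (planarFourier_clm (EuclideanSpace.proj (j, k) : GradMat →L[ℂ] ℂ) hi ξ).symm.trans
      (planarFourier_clm (EuclideanSpace.proj j : C3 →L[ℂ] ℂ) (hk k) ξ)
  rw [e]
  fin_cases k
  · have := planarFourier_slice_partialDeriv h1 hφ' t ξ 0
    simp only [symbolGrad, Fin.castSucc_zero] at this ⊢
    simp [this]
  · have := planarFourier_slice_partialDeriv h1 hφ' t ξ 1
    simp only [symbolGrad, Fin.castSucc_one] at this ⊢
    simp [this]
  · simp [symbolGrad]

variable {m h : ℝ}

/-- A general linear `T` covers the full gradient, the divergence and each curl component, the three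
squares in the null Lagrangian. -/
theorem plancherel_gradAt {H : Type*} [NormedAddCommGroup H] [InnerProductSpace ℂ H]
    [CompleteSpace H] (T : GradMat →L[ℂ] H) (hφ : ContDiff ℝ (⊤ : ℕ∞) φ)
    (hφ' : HasCompactSupport φ) (m h : ℝ) :
    Integrable (fun p : ℝ × R2 => ‖T (symbolGrad p.2 (planarFourier (slice φ p.1) p.2)
        (planarFourier (slice (partialDeriv 2 φ) p.1) p.2))‖ ^ 2)
        ((volume.restrict (Set.Ioo m h)).prod volume) ∧
      ∫ p : ℝ × R2, ‖T (symbolGrad p.2 (planarFourier (slice φ p.1) p.2)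
        (planarFourier (slice (partialDeriv 2 φ) p.1) p.2))‖ ^ 2
          ∂((volume.restrict (Set.Ioo m h)).prod volume) =
        ∫ x in {x : R3 | m < x 2 ∧ x 2 < h}, ‖T (gradAt φ x)‖ ^ 2 := by
  have hg := contDiff_gradAt hφ
  have hg' := hasCompactSupport_gradAt_of_hasCompactSupport hφ'
  have key := plancherel_slab (F := fun x => T (gradAt φ x))
    ((T.restrictScalars ℝ).contDiff.comp hg) (hg'.comp_left (g := T) (map_zero T)) m h
  have e : ∀ p : ℝ × R2, planarFourier (slice (fun x => T (gradAt φ x)) p.1) p.2 =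
      T (symbolGrad p.2 (planarFourier (slice φ p.1) p.2)
        (planarFourier (slice (partialDeriv 2 φ) p.1) p.2)) := by
    intro p
    rw [← planarFourier_slice_gradAt hφ hφ']
    exact planarFourier_clm T ((continuous_slice hg.continuous _).integrable_of_hasCompactSupport
      (hasCompactSupport_slice hg' _)) _
  simpa only [e] using key

theorem planarFourier_slice_eq_zero {t : ℝ} (hm : ∀ x : R3, x 2 = t → φ x = 0) (ξ : R2) :
    planarFourier (slice φ t) ξ = 0 := by
  have : slice φ t = fun _ => 0 := funext fun x => hm _ (planePoint_two t x)
  rw [planarFourier_eq, this]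
  simp

variable {m h : ℝ}

/-- Stated over an arbitrary measure space so that it applies both to the physical gradient and to
its Fourier-side version. -/
theorem integral_nullLagrangian {α : Type*} [MeasurableSpace α] {ν : Measure α}
    {G : α → GradMat} (h₁ : Integrable (fun a => ‖G a‖ ^ 2) ν)
    (h₂ : Integrable (fun a => ‖divCLM (G a)‖ ^ 2) ν)
    (h₃ : ∀ j, Integrable (fun a => ‖curlCLM j (G a)‖ ^ 2) ν) :
    Integrable (fun a => nullLagrangian (G a)) ν ∧
      ∫ a, nullLagrangian (G a) ∂ν = (∫ a, ‖G a‖ ^ 2 ∂ν) - (∫ a, ‖divCLM (G a)‖ ^ 2 ∂ν) -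
        ∑ j, ∫ a, ‖curlCLM j (G a)‖ ^ 2 ∂ν := by
  have eN : ∀ a, nullLagrangian (G a) = ‖G a‖ ^ 2 - ‖divCLM (G a)‖ ^ 2 -
      ∑ j, ‖curlCLM j (G a)‖ ^ 2 := fun a => by
    simp only [nullLagrangian, divCLM_apply, curlCLM_apply]
  have h₄ : Integrable (fun a => ‖G a‖ ^ 2 - ‖divCLM (G a)‖ ^ 2) ν := h₁.sub h₂
  have h₅ : Integrable (fun a => ∑ j, ‖curlCLM j (G a)‖ ^ 2) ν :=
    integrable_finsetSum _ fun j _ => h₃ j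
  simp only [eN]
  refine ⟨h₄.sub h₅, ?_⟩
  rw [integral_sub h₄ h₅, integral_sub h₁ h₂, integral_finsetSum _ fun j _ => h₃ j]

/-- Plancherel moves each of the squares to the Fourier side. There, after Fubini, the vertical
integral is that of an exact derivative, and only the value at `t = h` remains because `φ` vanishes
at `t = m`. -/
theorem nullLagrangian_slab (hφ : ContDiff ℝ (⊤ : ℕ∞) φ) (hφ' : HasCompactSupport φ)
    (hmh : m ≤ h) (hm : ∀ x : R3, x 2 = m → φ x = 0) :
    Integrable (fun ξ => nullForm ξ (planarFourier (slice φ h) ξ)) ∧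
    ∫ x in {x : R3 | m < x 2 ∧ x 2 < h}, nullLagrangian (gradAt φ x) =
      ∫ ξ, nullForm ξ (planarFourier (slice φ h) ξ) := by
  have h1 : ContDiff ℝ 1 φ := hφ.of_le (by exact_mod_cast le_top)
  have hg := (contDiff_gradAt hφ).continuous
  have hg' := hasCompactSupport_gradAt_of_hasCompactSupport hφ'
  have hS : ∀ {H : Type} [NormedAddCommGroup H] [InnerProductSpace ℂ H] (T : GradMat →L[ℂ] H),
      IntegrableOn (fun x => ‖T (gradAt φ x)‖ ^ 2) {x : R3 | m < x 2 ∧ x 2 < h} := by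
    intro H _ _ T
    refine (Continuous.integrable_of_hasCompactSupport (by fun_prop) ?_).integrableOn
    exact hg'.comp_left (g := fun G => ‖T G‖ ^ 2) (by simp)
  have hid := plancherel_gradAt (ContinuousLinearMap.id ℂ GradMat) hφ hφ' m h
  have hdiv := plancherel_gradAt divCLM hφ hφ' m h
  have hcurl := fun j => plancherel_gradAt (curlCLM j) hφ hφ' m h
  simp only [ContinuousLinearMap.id_apply] at hid
  obtain ⟨hint, hint'⟩ := integral_nullLagrangian hid.1 hdiv.1 fun j => (hcurl j).1
  have hval : ∀ ξ, ∫ t in Set.Ioo m h, nullLagrangian (symbolGrad ξ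
      (planarFourier (slice φ t) ξ) (planarFourier (slice (partialDeriv 2 φ) t) ξ)) =
      nullForm ξ (planarFourier (slice φ h) ξ) := by
    intro ξ
    rw [← integral_Ioc_eq_integral_Ioo, ← intervalIntegral.integral_of_le hmh]
    exact integral_nullLagrangian_symbolGrad ξ (continuous_planarFourier_slice_left
      (continuous_partialDeriv h1 2) (hasCompactSupport_partialDeriv hφ' 2) ξ)
      (fun t => hasDerivAt_planarFourier_slice h1 hφ' ξ t) (planarFourier_slice_eq_zero hm ξ)
  have hswap := integral_prod_symm _ hint
  have hR := hint.integral_prod_right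
  simp only [hval] at hswap hR
  refine ⟨hR, ?_⟩
  rw [← hswap, hint', hid.2, hdiv.2]
  simp only [(hcurl _).2]
  exact (integral_nullLagrangian (hS (ContinuousLinearMap.id ℂ GradMat)) (hS _) fun j => hS _).2

/-- Control of the traces of a field vanishing on the bottom plane by its gradient, at a fixed
horizontal frequency. -/
theorem exists_vertical_energy (hφ : ContDiff ℝ (⊤ : ℕ∞) φ) (hφ' : HasCompactSupport φ)
    (hmh : m ≤ h) (hm : ∀ x : R3, x 2 = m → φ x = 0) :
    ∃ J : R2 → ℝ, Integrable J ∧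
      ∫ ξ, J ξ = ∫ x in {x : R3 | m < x 2 ∧ x 2 < h}, ‖gradAt φ x‖ ^ 2 ∧
      (∀ ξ, ∀ t ∈ Set.Icc m h, ‖planarFourier (slice φ t) ξ‖ ^ 2 ≤ (h - m) * J ξ) ∧
      ∀ ξ, ‖ξ‖ * ‖planarFourier (slice φ h) ξ‖ ^ 2 ≤ J ξ := by
  have h1 : ContDiff ℝ 1 φ := hφ.of_le (by exact_mod_cast le_top)
  have hid := plancherel_gradAt (ContinuousLinearMap.id ℂ GradMat) hφ hφ' m h
  simp only [ContinuousLinearMap.id_apply] at hid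
  have hU := fun ξ t => hasDerivAt_planarFourier_slice h1 hφ' ξ t
  have hUc := continuous_planarFourier_slice_left hφ.continuous hφ'
  have hV := continuous_planarFourier_slice_left (continuous_partialDeriv h1 2)
    (hasCompactSupport_partialDeriv hφ' 2)
  have h0 := planarFourier_slice_eq_zero hm
  -- `J ξ` is the integral over `(m, h)` of `|ξ|²|û|² + |∂₃û|²`, the gradient energy at frequency
  -- `ξ`.
  refine ⟨_, hid.1.integral_prod_right, ?_, ?_, ?_⟩
  · rw [← hid.2, integral_prod_symm _ hid.1]
  · intro ξ t ht
    simp only [norm_sq_symbolGrad]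
    rw [← integral_Ioc_eq_integral_Ioo, ← intervalIntegral.integral_of_le hmh]
    refine (norm_sq_le_integral (U := fun t => planarFourier (slice φ t) ξ) ht.1 ht.2 (hV ξ)
      (hU ξ) (h0 ξ)).trans ?_
    refine mul_le_mul_of_nonneg_left ?_ (by linarith)
    have := hUc ξ
    have := hV ξ
    refine intervalIntegral.integral_mono_on hmh (Continuous.intervalIntegrable (by fun_prop) _ _)
      (Continuous.intervalIntegrable (by fun_prop) _ _) fun t _ => ?_
    exact le_add_of_nonneg_left (by positivity)
  · intro ξ
    simp only [norm_sq_symbolGrad]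
    rw [← integral_Ioc_eq_integral_Ioo, ← intervalIntegral.integral_of_le hmh]
    exact mul_norm_sq_le_integral (U := fun t => planarFourier (slice φ t) ξ) hmh (hV ξ) (hU ξ)
      (h0 ξ)

theorem norm_sq_slice_le (hφ : ContDiff ℝ (⊤ : ℕ∞) φ) (hφ' : HasCompactSupport φ)
    (hm : ∀ x : R3, x 2 = m → φ x = 0) {t : ℝ} (ht : t ∈ Set.Icc m h) :
    ∫ x, ‖slice φ t x‖ ^ 2 ≤
      (h - m) * ∫ x in {x : R3 | m < x 2 ∧ x 2 < h}, ‖gradAt φ x‖ ^ 2 := by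
  obtain ⟨J, hJ, hJ', hJ1, -⟩ := exists_vertical_energy hφ hφ' (ht.1.trans ht.2) hm
  have hP := plancherel_planarFourier (contDiff_slice hφ t) (hasCompactSupport_slice hφ' t)
  rw [← hJ', ← hP.2, ← integral_const_mul]
  exact integral_mono hP.1 (hJ.const_mul _) fun ξ => hJ1 ξ t ht

theorem norm_sq_slab_le (hφ : ContDiff ℝ (⊤ : ℕ∞) φ) (hφ' : HasCompactSupport φ)
    (hmh : m ≤ h) (hm : ∀ x : R3, x 2 = m → φ x = 0) :
    ∫ x in {x : R3 | m < x 2 ∧ x 2 < h}, ‖φ x‖ ^ 2 ≤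
      (h - m) ^ 2 * ∫ x in {x : R3 | m < x 2 ∧ x 2 < h}, ‖gradAt φ x‖ ^ 2 := by
  have hN : Continuous fun x => ‖φ x‖ ^ 2 := hφ.continuous.norm.pow 2
  have hN' : HasCompactSupport fun x => ‖φ x‖ ^ 2 :=
    hφ'.comp_left (g := fun v => ‖v‖ ^ 2) (by simp)
  rw [setIntegral_slab hN hN']
  refine (setIntegral_mono_on ((continuous_integral_slice hN hN').integrableOn_Icc.mono_set
    Set.Ioo_subset_Icc_self) (integrableOn_const (by simp)) measurableSet_Ioo
    fun t ht => norm_sq_slice_le hφ hφ' hm (Set.Ioo_subset_Icc_self ht)).trans ?_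
  rw [setIntegral_const, Real.volume_real_Ioo_of_le hmh, smul_eq_mul, ← mul_assoc, ← pow_two]

theorem integral_norm_mul_trace_le (hφ : ContDiff ℝ (⊤ : ℕ∞) φ) (hφ' : HasCompactSupport φ)
    (hmh : m ≤ h) (hm : ∀ x : R3, x 2 = m → φ x = 0) :
    Integrable (fun ξ => ‖ξ‖ * ‖planarFourier (slice φ h) ξ‖ ^ 2) ∧
    ∫ ξ, ‖ξ‖ * ‖planarFourier (slice φ h) ξ‖ ^ 2 ≤
      ∫ x in {x : R3 | m < x 2 ∧ x 2 < h}, ‖gradAt φ x‖ ^ 2 := by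
  obtain ⟨J, hJ, hJ', -, hJ1⟩ := exists_vertical_energy hφ hφ' hmh hm
  have hc := continuous_planarFourier_slice_right hφ.continuous hφ' h
  have hint : Integrable (fun ξ => ‖ξ‖ * ‖planarFourier (slice φ h) ξ‖ ^ 2) := by
    refine hJ.mono' (Continuous.aestronglyMeasurable (by fun_prop))
      (Filter.Eventually.of_forall fun ξ => ?_)
    rw [Real.norm_of_nonneg (by positivity)]
    exact hJ1 ξ
  refine ⟨hint, ?_⟩
  rw [← hJ']
  exact integral_mono hint hJ hJ1

end testFunctions

/-! ### Sesquilinear forms given by integrals, and the Lax–Milgram lemma -/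

section abstractForms

/-- The sesquilinear form `(v, u) ↦ ∫ q (P v) (P u)` for an almost everywhere linear `P`. -/
def integralForm {V E α : Type*} [AddCommGroup V] [Module ℂ V] [AddCommGroup E] [Module ℂ E]
    [MeasurableSpace α] (ν : Measure α) (P : V → α → E) (q : α → E →ₗ⋆[ℂ] E →ₗ[ℂ] ℂ)
    (hadd : ∀ u v, P (u + v) =ᵐ[ν] P u + P v) (hsmul : ∀ (c : ℂ) u, P (c • u) =ᵐ[ν] c • P u)
    (hint : ∀ u v, Integrable (fun x => q x (P v x) (P u x)) ν) : V →ₗ⋆[ℂ] V →ₗ[ℂ] ℂ :=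
  LinearMap.mk₂'ₛₗ (starRingEnd ℂ) (RingHom.id ℂ) (fun v u => ∫ x, q x (P v x) (P u x) ∂ν)
    (fun v v' u => by
      rw [← integral_add (hint _ _) (hint _ _)]
      refine integral_congr_ae ?_
      filter_upwards [hadd v v'] with x hx
      rw [hx, Pi.add_apply, map_add, LinearMap.add_apply])
    (fun c v u => by
      rw [smul_eq_mul, ← integral_const_mul]
      refine integral_congr_ae ?_
      filter_upwards [hsmul c v] with x hx
      rw [hx, Pi.smul_apply, LinearMap.map_smulₛₗ, LinearMap.smul_apply, smul_eq_mul])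
    (fun v u u' => by
      rw [← integral_add (hint _ _) (hint _ _)]
      refine integral_congr_ae ?_
      filter_upwards [hadd u u'] with x hx
      rw [hx, Pi.add_apply, map_add])
    (fun c v u => by
      rw [RingHom.id_apply, smul_eq_mul, ← integral_const_mul]
      refine integral_congr_ae ?_
      filter_upwards [hsmul c u] with x hx
      rw [hx, Pi.smul_apply, map_smul, smul_eq_mul])

variable {V : Type*} [NormedAddCommGroup V]

/-- Normalizing both arguments turns an additive bound into a multiplicative one. The integral forms
can therefore be estimated pointwise by sums of squares. -/
theorem norm_form_le_of_le_add [NormedSpace ℂ V] {B : V →ₗ⋆[ℂ] V →ₗ[ℂ] ℂ} {C : ℝ}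
    (hB : ∀ u v, ‖B v u‖ ≤ C * (‖u‖ ^ 2 + ‖v‖ ^ 2)) (v u : V) :
    ‖B v u‖ ≤ 2 * C * ‖v‖ * ‖u‖ := by
  rcases eq_or_ne v 0 with rfl | hv
  · simp
  rcases eq_or_ne u 0 with rfl | hu
  · simp
  have hv' := norm_pos_iff.2 hv
  have hu' := norm_pos_iff.2 hu
  have h := hB (((‖u‖⁻¹ : ℝ) : ℂ) • u) (((‖v‖⁻¹ : ℝ) : ℂ) • v)
  rw [map_smul, LinearMap.map_smulₛₗ, LinearMap.smul_apply, norm_smul, norm_smul, norm_smul,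
    norm_smul, RCLike.norm_conj, Complex.norm_real, Complex.norm_real, norm_inv, norm_inv,
    norm_norm, norm_norm, inv_mul_cancel₀ hu'.ne', inv_mul_cancel₀ hv'.ne', ← mul_assoc,
    ← mul_inv, inv_mul_le_iff₀ (by positivity)] at h
  linarith

variable [InnerProductSpace ℂ V] [CompleteSpace V]

/-- **Lax–Milgram lemma** for a coercive bounded sesquilinear form, conjugate linear in the first
argument. -/
theorem existsUnique_of_coercive (B : V →ₗ⋆[ℂ] V →ₗ[ℂ] ℂ) {C c : ℝ}
    (hB : ∀ v u, ‖B v u‖ ≤ C * ‖v‖ * ‖u‖) (hc : 0 < c) (hcoer : ∀ u, c * ‖u‖ ^ 2 ≤ (B u u).re)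
    (w : V) : ∃! u, ∀ v, B v u = inner ℂ v w := by
  let T := InnerProductSpace.continuousLinearMapOfBilin (B.mkContinuous₂ C hB)
  have hT : ∀ v u, inner ℂ (T v) u = B v u := fun v u =>
    InnerProductSpace.continuousLinearMapOfBilin_apply _ v u
  have hunit : IsUnit T := by
    refine ContinuousLinearMap.isUnit_of_forall_le_norm_inner_map T (c := ⟨c, hc.le⟩) hc
      fun u => ?_
    rw [hT, mul_comm]
    exact (hcoer u).trans (Complex.re_le_norm _)
  -- `T` represents `B` through its first slot, while the unknown sits in the second, so the
  -- equation to invert is the one for the adjoint.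
  have hbij : Function.Bijective (ContinuousLinearMap.adjoint T) :=
    ContinuousLinearMap.isUnit_iff_bijective.1 hunit.star
  obtain ⟨u, hu, huniq⟩ := hbij.existsUnique w
  have hiff : ∀ u, (∀ v, B v u = inner ℂ v w) ↔ ContinuousLinearMap.adjoint T u = w := by
    intro u
    simp only [← hT, ← ContinuousLinearMap.adjoint_inner_right]
    exact ⟨fun h => ext_inner_left ℂ h, fun h v => by rw [h]⟩
  exact ⟨u, (hiff u).2 hu, fun y hy => huniq y ((hiff y).1 hy)⟩

end abstractForms

/-! ### The Fourier transform of traces -/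

section hat

theorem two_pi_inv_pos : (0 : ℝ) < (2 * Real.pi)⁻¹ := by positivity

theorem hat_add (v w : Lp C3 2 (volume : Measure R2)) : hat (v + w) =ᵐ[volume] hat v + hat w := by
  have h : (𝓕 (v + w) : Lp C3 2 (volume : Measure R2)) = 𝓕 v + 𝓕 w := FourierAdd.fourier_add v w
  have h2 := (Measure.quasiMeasurePreserving_smul (volume : Measure R2)
    two_pi_inv_pos.ne').ae_eq_comp (Lp.coeFn_add (𝓕 v) (𝓕 w))
  filter_upwards [h2] with ξ hξ
  simp only [Function.comp_apply, Pi.add_apply] at hξ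
  simp only [hat, Pi.add_apply, h, hξ, smul_add]

theorem hat_smul (c : ℂ) (v : Lp C3 2 (volume : Measure R2)) :
    hat (c • v) =ᵐ[volume] c • hat v := by
  have h : (𝓕 (c • v) : Lp C3 2 (volume : Measure R2)) = c • 𝓕 v := FourierSMul.fourier_smul c v
  have h2 := (Measure.quasiMeasurePreserving_smul (volume : Measure R2)
    two_pi_inv_pos.ne').ae_eq_comp (Lp.coeFn_smul c (𝓕 v))
  filter_upwards [h2] with ξ hξ
  simp only [Function.comp_apply, Pi.smul_apply] at hξ
  simp only [hat, Pi.smul_apply, h, hξ]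
  exact smul_comm _ _ _

theorem aestronglyMeasurable_hat (v : Lp C3 2 (volume : Measure R2)) :
    AEStronglyMeasurable (hat v) volume :=
  ((Lp.aestronglyMeasurable (𝓕 v)).comp_quasiMeasurePreserving
    (Measure.quasiMeasurePreserving_smul (volume : Measure R2) two_pi_inv_pos.ne')).const_smul ((2 * Real.pi)⁻¹ : ℝ)

theorem Lp_norm_sq {α E : Type*} [MeasurableSpace α] {ν : Measure α} [NormedAddCommGroup E]
    [InnerProductSpace ℂ E] (f : Lp E 2 ν) : ‖f‖ ^ 2 = ∫ x, ‖f x‖ ^ 2 ∂ν := by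
  have h : (inner ℂ f f : ℂ) = ((∫ x, ‖f x‖ ^ 2 ∂ν : ℝ) : ℂ) := by
    rw [L2.inner_def, ← integral_complex_ofReal]
    simp only [inner_self_eq_norm_sq_to_K]
    simp
  rw [inner_self_eq_norm_sq_to_K] at h
  exact Complex.ofReal_injective ((Complex.ofReal_pow _ _).trans h)

theorem hat_norm_sq (v : Lp C3 2 (volume : Measure R2)) :
    Integrable (fun ξ => ‖hat v ξ‖ ^ 2) ∧ ∫ ξ, ‖hat v ξ‖ ^ 2 = ‖v‖ ^ 2 := by
  have e : ∀ ξ, ‖hat v ξ‖ ^ 2 = ((2 * Real.pi)⁻¹) ^ 2 *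
      ‖(𝓕 v : Lp C3 2 (volume : Measure R2)) (((2 * Real.pi)⁻¹ : ℝ) • ξ)‖ ^ 2 := by
    intro ξ
    rw [hat, norm_smul, mul_pow, Real.norm_of_nonneg two_pi_inv_pos.le]
  have hint : Integrable fun η => ‖(𝓕 v : Lp C3 2 (volume : Measure R2)) η‖ ^ 2 :=
    (Lp.memLp (𝓕 v)).integrable_norm_pow two_ne_zero
  have hk := Measure.integral_comp_smul volume
    (fun η => ‖(𝓕 v : Lp C3 2 (volume : Measure R2)) η‖ ^ 2) (2 * Real.pi)⁻¹
  simp only [e]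
  refine ⟨(hint.comp_smul two_pi_inv_pos.ne').const_mul _, ?_⟩
  rw [integral_const_mul, hk, finrank_euclideanSpace_fin, smul_eq_mul, abs_of_pos (by positivity),
    ← mul_assoc, mul_inv_cancel₀ (by positivity), one_mul, ← Lp_norm_sq, Lp.norm_fourier_eq]

/-- Links the `L²` Fourier transform, defined by extension, to the explicit integral: the slice of a
test function is a Schwartz function, where the two agree. -/
theorem hat_testTrace {D : Opens R3} (h : ℝ) (φ : 𝓓(D, C3)) :
    hat (testTrace D h φ) =ᵐ[volume] planarFourier (slice φ h) := by
  set g := (hasCompactSupport_slice φ.hasCompactSupport h).toSchwartzMap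
    (contDiff_slice φ.contDiff h) with hg
  have e : testTrace D h φ = g.toLp 2 := rfl
  have e2 : (𝓕 (testTrace D h φ) : Lp C3 2 (volume : Measure R2)) = (𝓕 g).toLp 2 := by
    rw [e, SchwartzMap.toLp_fourier_eq]
  have h2 := (Measure.quasiMeasurePreserving_smul (volume : Measure R2)
    two_pi_inv_pos.ne').ae_eq_comp ((𝓕 g).coeFn_toLp 2)
  filter_upwards [h2] with ξ hξ
  simp only [Function.comp_apply] at hξ
  rw [hat, e2, hξ, planarFourier]
  rfl

/-- The bound of the weighted norm `∫ |ξ| |v̂|²` passes to `L²` limits. -/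
theorem lintegral_norm_mul_hat_le_of_tendsto {v : ℕ → Lp C3 2 (volume : Measure R2)}
    {w : Lp C3 2 (volume : Measure R2)} (hv : Filter.Tendsto v Filter.atTop (nhds w))
    {c : ℕ → ENNReal} {C : ENNReal} (hc : Filter.Tendsto c Filter.atTop (nhds C))
    (hb : ∀ n, ∫⁻ ξ, ENNReal.ofReal (‖ξ‖ * ‖hat (v n) ξ‖ ^ 2) ≤ c n) :
    ∫⁻ ξ, ENNReal.ofReal (‖ξ‖ * ‖hat w ξ‖ ^ 2) ≤ C := by
  have hF : Filter.Tendsto (fun n => (𝓕 (v n) : Lp C3 2 (volume : Measure R2))) Filter.atTop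
      (nhds (𝓕 w)) := by
    rw [tendsto_iff_norm_sub_tendsto_zero] at hv ⊢
    refine hv.congr fun n => ?_
    rw [← Lp.norm_fourier_eq]
    exact congrArg _ (map_sub (Lp.fourierTransformₗᵢ R2 C3) _ _)
  -- Convergence in `L²` gives almost everywhere convergence along a subsequence, which is what
  -- Fatou's lemma needs.
  obtain ⟨s, hs, hae⟩ := (tendstoInMeasure_of_tendsto_Lp hF).exists_seq_tendsto_ae
  have hae2 : ∀ᵐ ξ : R2, Filter.Tendsto (fun n => hat (v (s n)) ξ) Filter.atTop
      (nhds (hat w ξ)) := by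
    filter_upwards [(Measure.quasiMeasurePreserving_smul (volume : Measure R2)
      two_pi_inv_pos.ne').ae hae] with ξ hξ
    exact hξ.const_smul _
  calc ∫⁻ ξ, ENNReal.ofReal (‖ξ‖ * ‖hat w ξ‖ ^ 2)
      = ∫⁻ ξ, Filter.liminf (fun n => ENNReal.ofReal (‖ξ‖ * ‖hat (v (s n)) ξ‖ ^ 2))
          Filter.atTop := by
        refine lintegral_congr_ae ?_
        filter_upwards [hae2] with ξ hξ
        exact (Filter.Tendsto.liminf_eq
          (ENNReal.tendsto_ofReal ((hξ.norm.pow 2).const_mul ‖ξ‖))).symm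
    _ ≤ Filter.liminf (fun n => ∫⁻ ξ, ENNReal.ofReal (‖ξ‖ * ‖hat (v (s n)) ξ‖ ^ 2))
          Filter.atTop := by
        refine lintegral_liminf_le' fun n => ?_
        have := aestronglyMeasurable_hat (v (s n))
        exact (continuous_norm.aestronglyMeasurable.mul (this.norm.pow 2)).aemeasurable.ennreal_ofReal
    _ ≤ Filter.liminf (fun n => c (s n)) Filter.atTop :=
        Filter.liminf_le_liminf (Filter.Eventually.of_forall fun n => hb (s n))
    _ = C := (hc.comp hs.tendsto_atTop).liminf_eq

end hat

/-! ### The energy space -/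

section energySpace

variable {D : Opens R3} {m h : ℝ}

theorem closure_upperHalf (a : ℝ) : closure (upperHalf a) = {x : R3 | a ≤ x 2} := by
  have hopen : IsOpenMap (EuclideanSpace.proj (𝕜 := ℝ) (2 : Fin 3) : R3 →L[ℝ] ℝ) := by
    refine ContinuousLinearMap.isOpenMap _ fun t => ⟨EuclideanSpace.single 2 t, by simp⟩
  have := hopen.preimage_closure_eq_closure_preimage
    (EuclideanSpace.proj (𝕜 := ℝ) (2 : Fin 3) : R3 →L[ℝ] ℝ).continuous (Set.Ioi a)
  rw [closure_Ioi] at this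
  exact this.symm

theorem mem_strip {x : R3} : x ∈ strip D h ↔ x ∈ D ∧ x 2 < h := by
  rw [strip, closure_upperHalf]
  simp

/-- Extension by zero replaces the rough strip by the flat slab `m < x₃ < h`, where horizontal
Fourier analysis applies. -/
theorem setIntegral_strip_eq_slab (hD : (D : Set R3) ⊆ upperHalf m) {F : R3 → ℝ}
    (hF : ∀ x ∉ D, F x = 0) :
    ∫ x in strip D h, F x = ∫ x in {x : R3 | m < x 2 ∧ x 2 < h}, F x := by
  refine (setIntegral_eq_of_subset_of_forall_sdiff_eq_zero ?_ (fun x hx => ?_) fun x hx => ?_).symm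
  · have hc : Continuous fun x : R3 => x 2 := by fun_prop
    exact (measurableSet_lt measurable_const hc.measurable).inter
      (measurableSet_lt hc.measurable measurable_const)
  · exact ⟨hD (mem_strip.1 hx).1, (mem_strip.1 hx).2⟩
  · exact hF x fun hxD => hx.2 (mem_strip.2 ⟨hxD, hx.1.2⟩)

/-- The function underlying an element of `V_h`, in `L²`. -/
def fnL2 (D : Opens R3) (h : ℝ) : energySpace D h →L[ℂ] Lp C3 2 (volume.restrict (strip D h)) :=
  (WithLp.fstL 2 ℂ _ _).comp (energySpace D h).subtypeL

/-- The gradient of an element of `V_h`, in `L²`. -/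
def gradL2 (D : Opens R3) (h : ℝ) :
    energySpace D h →L[ℂ] Lp GradMat 2 (volume.restrict (strip D h)) :=
  (WithLp.sndL 2 ℂ _ _).comp (energySpace D h).subtypeL

theorem norm_sq_energySpace (u : energySpace D h) :
    ‖u‖ ^ 2 = ‖fnL2 D h u‖ ^ 2 + ‖gradL2 D h u‖ ^ 2 :=
  WithLp.prod_norm_sq_eq_of_L2 (u : GradPair (strip D h))

instance : CompleteSpace (energySpace D h) :=
  inferInstanceAs (CompleteSpace (LinearMap.range (testPair D h)).topologicalClosure)

theorem denseRange_testToEnergy : DenseRange (testToEnergy D h) := by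
  intro u
  rw [closure_subtype]
  have : ((↑) : energySpace D h → GradPair (strip D h)) '' Set.range (testToEnergy D h) =
      (LinearMap.range (testPair D h) : Set (GradPair (strip D h))) := by
    rw [← Set.range_comp]
    rfl
  rw [this]
  exact u.2

theorem norm_sq_toLp {α E : Type*} [MeasurableSpace α] {ν : Measure α} [NormedAddCommGroup E]
    [InnerProductSpace ℂ E] {f : α → E} (hf : MemLp f 2 ν) :
    ‖hf.toLp f‖ ^ 2 = ∫ x, ‖f x‖ ^ 2 ∂ν := by
  rw [Lp_norm_sq]
  refine integral_congr_ae ?_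
  filter_upwards [hf.coeFn_toLp] with x hx
  rw [hx]

theorem fn_testToEnergy (φ : 𝓓(D, C3)) :
    fn (testToEnergy D h φ) =ᵐ[volume.restrict (strip D h)] φ :=
  (memLp_test φ (strip D h)).coeFn_toLp

theorem grad_testToEnergy (φ : 𝓓(D, C3)) :
    grad (testToEnergy D h φ) =ᵐ[volume.restrict (strip D h)] gradAt φ :=
  (memLp_gradAt φ (strip D h)).coeFn_toLp

theorem test_eq_zero (φ : 𝓓(D, C3)) {x : R3} (hx : x ∉ D) : φ x = 0 :=
  image_eq_zero_of_notMem_tsupport fun hx' => hx (φ.tsupport_subset hx')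

theorem gradAt_test_eq_zero (φ : 𝓓(D, C3)) {x : R3} (hx : x ∉ D) : gradAt φ x = 0 := by
  have : fderiv ℝ φ x = 0 := by
    refine image_eq_zero_of_notMem_tsupport fun hx' => hx (φ.tsupport_subset ?_)
    exact tsupport_fderiv_subset ℝ hx'
  ext p
  simp [gradAt, this]

theorem test_eq_zero_of_bottom (hD : (D : Set R3) ⊆ upperHalf m) (φ : 𝓓(D, C3)) :
    ∀ x : R3, x 2 = m → φ x = 0 :=
  fun _ hx => test_eq_zero φ fun hxD => (hD hxD).ne' hx

theorem norm_sq_gradL2_test (hD : (D : Set R3) ⊆ upperHalf m) (φ : 𝓓(D, C3)) :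
    ‖gradL2 D h (testToEnergy D h φ)‖ ^ 2 =
      ∫ x in {x : R3 | m < x 2 ∧ x 2 < h}, ‖gradAt φ x‖ ^ 2 := by
  rw [← setIntegral_strip_eq_slab hD fun x hx => by rw [gradAt_test_eq_zero φ hx]; simp]
  exact norm_sq_toLp (memLp_gradAt φ (strip D h))

theorem norm_sq_fnL2_test_le (hD : (D : Set R3) ⊆ upperHalf m) (hmh : m ≤ h) (φ : 𝓓(D, C3)) :
    ‖fnL2 D h (testToEnergy D h φ)‖ ^ 2 ≤
      (h - m) ^ 2 * ‖gradL2 D h (testToEnergy D h φ)‖ ^ 2 := by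
  rw [norm_sq_gradL2_test hD]
  refine le_trans (le_of_eq ?_) (norm_sq_slab_le φ.contDiff φ.hasCompactSupport hmh
    (test_eq_zero_of_bottom hD φ))
  rw [← setIntegral_strip_eq_slab hD fun x hx => by rw [test_eq_zero φ hx]; simp]
  exact norm_sq_toLp (memLp_test φ (strip D h))

theorem norm_sq_testTrace_le (hD : (D : Set R3) ⊆ upperHalf m) (hmh : m ≤ h) (φ : 𝓓(D, C3)) :
    ‖testTrace D h φ‖ ^ 2 ≤ (h - m) * ‖gradL2 D h (testToEnergy D h φ)‖ ^ 2 := by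
  rw [norm_sq_gradL2_test hD]
  refine le_trans (le_of_eq ?_) (norm_sq_slice_le φ.contDiff φ.hasCompactSupport
    (test_eq_zero_of_bottom hD φ) (Set.right_mem_Icc.2 hmh))
  exact norm_sq_toLp (memLp_planeRestrict h φ)

/-- The extension defining `trace` agrees with restriction only in the presence of density and a
norm bound; the slice estimate at `t = h` provides the bound. -/
theorem trace_testToEnergy (hD : (D : Set R3) ⊆ upperHalf m) (hmh : m ≤ h) (φ : 𝓓(D, C3)) :
    trace D h (testToEnergy D h φ) = testTrace D h φ := by
  refine LinearMap.extendOfNorm_eq denseRange_testToEnergy ⟨√(h - m), fun φ => ?_⟩ φ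
  have h0 : 0 ≤ h - m := by linarith
  refine abs_le_of_sq_le_sq' ?_ (by positivity) |>.2
  rw [mul_pow, Real.sq_sqrt h0]
  refine (norm_sq_testTrace_le hD hmh φ).trans ?_
  refine mul_le_mul_of_nonneg_left ?_ h0
  rw [norm_sq_energySpace]
  exact le_add_of_nonneg_left (sq_nonneg _)

theorem norm_sq_fnL2_le (hD : (D : Set R3) ⊆ upperHalf m) (hmh : m ≤ h) (u : energySpace D h) :
    ‖fnL2 D h u‖ ^ 2 ≤ (h - m) ^ 2 * ‖gradL2 D h u‖ ^ 2 :=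
  denseRange_testToEnergy.induction_on u
    (isClosed_le (by fun_prop) (by fun_prop)) (norm_sq_fnL2_test_le hD hmh)

theorem norm_sq_trace_le (hD : (D : Set R3) ⊆ upperHalf m) (hmh : m ≤ h) (u : energySpace D h) :
    ‖trace D h u‖ ^ 2 ≤ (h - m) * ‖gradL2 D h u‖ ^ 2 :=
  denseRange_testToEnergy.induction_on u
    (isClosed_le (by fun_prop) (by fun_prop)) fun φ => by
      rw [trace_testToEnergy hD hmh]
      exact norm_sq_testTrace_le hD hmh φ

/-- The trace belongs to `H^{1/2}`, on the Fourier side. -/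
theorem integral_norm_mul_hat_trace_le (hD : (D : Set R3) ⊆ upperHalf m) (hmh : m ≤ h)
    (u : energySpace D h) :
    Integrable (fun ξ => ‖ξ‖ * ‖hat (trace D h u) ξ‖ ^ 2) ∧
      ∫ ξ, ‖ξ‖ * ‖hat (trace D h u) ξ‖ ^ 2 ≤ ‖gradL2 D h u‖ ^ 2 := by
  have hmeas : AEStronglyMeasurable (fun ξ => ‖ξ‖ * ‖hat (trace D h u) ξ‖ ^ 2) volume :=
    continuous_norm.aestronglyMeasurable.mul ((aestronglyMeasurable_hat _).norm.pow 2)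
  have hnn : 0 ≤ᵐ[volume] fun ξ => ‖ξ‖ * ‖hat (trace D h u) ξ‖ ^ 2 :=
    Filter.Eventually.of_forall fun ξ => by positivity
  -- Continuity of the weighted norm in `u` is not yet known, so the closed-set density argument is
  -- replaced by lower semicontinuity along a sequence of test functions.
  obtain ⟨x, hx, hxu⟩ := mem_closure_iff_seq_limit.1 (denseRange_testToEnergy u)
  have hle : ∫⁻ ξ, ENNReal.ofReal (‖ξ‖ * ‖hat (trace D h u) ξ‖ ^ 2) ≤
      ENNReal.ofReal (‖gradL2 D h u‖ ^ 2) := by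
    refine lintegral_norm_mul_hat_le_of_tendsto (((trace D h).continuous.tendsto u).comp hxu)
      (ENNReal.tendsto_ofReal (((gradL2 D h).continuous.norm.pow 2).tendsto u |>.comp hxu))
      fun n => ?_
    obtain ⟨φ, hφ⟩ := hx n
    have key := integral_norm_mul_trace_le φ.contDiff φ.hasCompactSupport hmh
      (test_eq_zero_of_bottom hD φ)
    simp only [Function.comp_apply, Pi.pow_apply, ← hφ]
    rw [trace_testToEnergy hD hmh, norm_sq_gradL2_test hD]
    refine le_trans (le_of_eq ?_) (ENNReal.ofReal_le_ofReal key.2)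
    rw [ofReal_integral_eq_lintegral_ofReal key.1
      (Filter.Eventually.of_forall fun ξ => by positivity)]
    refine lintegral_congr_ae ?_
    filter_upwards [hat_testTrace h φ] with ξ hξ
    rw [hξ]
  have hint : Integrable (fun ξ => ‖ξ‖ * ‖hat (trace D h u) ξ‖ ^ 2) :=
    ⟨hmeas, (hasFiniteIntegral_iff_ofReal hnn).2 (hle.trans_lt ENNReal.ofReal_lt_top)⟩
  refine ⟨hint, ?_⟩
  rw [← ofReal_integral_eq_lintegral_ofReal hint hnn] at hle
  exact (ENNReal.ofReal_le_ofReal_iff (sq_nonneg _)).1 hle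

end energySpace

/-! ### The variational form -/

section form

variable {D : Opens R3} {m h : ℝ} {lam mu ω : ℝ}

theorem fn_add (u v : energySpace D h) :
    fn (u + v) =ᵐ[volume.restrict (strip D h)] fn u + fn v := Lp.coeFn_add _ _

theorem fn_smul (c : ℂ) (u : energySpace D h) :
    fn (c • u) =ᵐ[volume.restrict (strip D h)] c • fn u := Lp.coeFn_smul _ _

theorem grad_add (u v : energySpace D h) :
    grad (u + v) =ᵐ[volume.restrict (strip D h)] grad u + grad v := Lp.coeFn_add _ _

theorem grad_smul (c : ℂ) (u : energySpace D h) :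
    grad (c • u) =ᵐ[volume.restrict (strip D h)] c • grad u := Lp.coeFn_smul _ _

/-- The integrand of the volume part of `B` as a sesquilinear form. -/
def volumeSesq (lam mu ω : ℝ) : C3 × GradMat →ₗ⋆[ℂ] C3 × GradMat →ₗ[ℂ] ℂ :=
  LinearMap.mk₂'ₛₗ (starRingEnd ℂ) (RingHom.id ℂ)
    (fun q p => energyDensity lam mu p.2 q.2 - ω ^ 2 * ∑ j, p.1 j * conj (q.1 j))
    (fun q q' p => by
      simp [energyDensity, divG, curlG, Fin.sum_univ_three]; ring)
    (fun c q p => by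
      simp [energyDensity, divG, curlG, Fin.sum_univ_three]; ring)
    (fun q p p' => by
      simp [energyDensity, divG, curlG, Fin.sum_univ_three]; ring)
    (fun c q p => by
      simp [energyDensity, divG, curlG, Fin.sum_univ_three]; ring)

/-- The form of the symbol as a bundled sesquilinear form. -/
def symbolSesq (lam mu ω : ℝ) (ξ : R2) : C3 →ₗ⋆[ℂ] C3 →ₗ[ℂ] ℂ :=
  LinearMap.mk₂'ₛₗ (starRingEnd ℂ) (RingHom.id ℂ) (fun b a => symbolForm lam mu ω ξ a b)
    (fun b b' a => by simp [symbolForm, mul_add, Finset.sum_add_distrib])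
    (fun c b a => by
      simp only [symbolForm, Finset.mul_sum, smul_eq_mul, PiLp.smul_apply, map_mul]
      exact Finset.sum_congr rfl fun _ _ => by ring)
    (fun b a a' => by
      simp [symbolForm, Matrix.mulVec_add, add_mul, mul_add, Finset.sum_add_distrib])
    (fun c b a => by
      simp only [symbolForm, WithLp.ofLp_smul, Matrix.mulVec_smul, smul_comm Complex.I c,
        Pi.smul_apply _ (Complex.I • _), Finset.mul_sum, smul_eq_mul, RingHom.id_apply, mul_assoc])

theorem continuous_volumeSesq : Continuous fun x : (C3 × GradMat) × (C3 × GradMat) =>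
    volumeSesq lam mu ω x.1 x.2 := by
  have := Complex.continuous_conj
  simp only [volumeSesq, LinearMap.mk₂'ₛₗ_apply, energyDensity, divG, curlG, Fin.sum_univ_three,
    Matrix.cons_val_zero, Matrix.cons_val_one, Matrix.cons_val]
  fun_prop

/-- The constant bounding the volume part of `B`. -/
def volumeConst (lam mu ω : ℝ) : ℝ :=
  2 * |mu| + |lam| * ‖divCLM‖ ^ 2 + |mu| * ∑ j, ‖curlCLM j‖ ^ 2 + ω ^ 2

theorem norm_sum_mul_conj_le {ι : Type*} [Fintype ι] (a b : EuclideanSpace ℂ ι) :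
    ‖∑ j, a j * conj (b j)‖ ≤ ‖a‖ * ‖b‖ := by
  have : ∑ j, a j * conj (b j) = inner ℂ b a := by
    rw [PiLp.inner_apply]
    rfl
  rw [this, mul_comm]
  exact norm_inner_le_norm _ _

theorem norm_volumeSesq_le (q p : C3 × GradMat) :
    ‖volumeSesq lam mu ω q p‖ ≤ volumeConst lam mu ω *
      ((‖p.1‖ ^ 2 + ‖p.2‖ ^ 2) + (‖q.1‖ ^ 2 + ‖q.2‖ ^ 2)) := by
  obtain ⟨b, H⟩ := q
  obtain ⟨a, G⟩ := p
  have hdiv : ‖divG G * conj (divG H)‖ ≤ ‖divCLM‖ ^ 2 * (‖G‖ * ‖H‖) := by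
    rw [norm_mul, RCLike.norm_conj, ← divCLM_apply, ← divCLM_apply]
    calc _ ≤ (‖divCLM‖ * ‖G‖) * (‖divCLM‖ * ‖H‖) := by
          gcongr <;> exact ContinuousLinearMap.le_opNorm _ _
      _ = _ := by ring
  have hcurl : ‖∑ j, curlG G j * conj (curlG H j)‖ ≤
      (∑ j, ‖curlCLM j‖ ^ 2) * (‖G‖ * ‖H‖) := by
    rw [Finset.sum_mul]
    refine (norm_sum_le _ _).trans (Finset.sum_le_sum fun j _ => ?_)
    rw [norm_mul, RCLike.norm_conj, ← curlCLM_apply, ← curlCLM_apply]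
    calc _ ≤ (‖curlCLM j‖ * ‖G‖) * (‖curlCLM j‖ * ‖H‖) := by
          gcongr <;> exact ContinuousLinearMap.le_opNorm _ _
      _ = _ := by ring
  have hgrad : ‖∑ j : Fin 3, ∑ k : Fin 3, G (j, k) * conj (H (j, k))‖ ≤ ‖G‖ * ‖H‖ := by
    rw [← Fintype.sum_prod_type']
    exact norm_sum_mul_conj_le G H
  have hfn := norm_sum_mul_conj_le a b
  have h0 : ‖volumeSesq lam mu ω (b, H) (a, G)‖ ≤ 2 * |mu| * (‖G‖ * ‖H‖) +
      |lam| * (‖divCLM‖ ^ 2 * (‖G‖ * ‖H‖)) +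
      |mu| * ((∑ j, ‖curlCLM j‖ ^ 2) * (‖G‖ * ‖H‖)) + ω ^ 2 * (‖a‖ * ‖b‖) := by
    rw [volumeSesq, LinearMap.mk₂'ₛₗ_apply, energyDensity]
    refine (norm_sub_le _ _).trans (add_le_add ((norm_sub_le _ _).trans
      (add_le_add ((norm_add_le _ _).trans (add_le_add ?_ ?_)) ?_)) ?_)
    · rw [norm_mul, norm_mul, Complex.norm_real, Complex.norm_ofNat, Real.norm_eq_abs]
      gcongr
    · rw [norm_mul, Complex.norm_real, Real.norm_eq_abs]
      gcongr
    · rw [norm_mul, Complex.norm_real, Real.norm_eq_abs]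
      gcongr
    · rw [norm_mul, norm_pow, Complex.norm_real, Real.norm_eq_abs, sq_abs]
      gcongr
  have h1 : ‖G‖ * ‖H‖ ≤ (‖a‖ ^ 2 + ‖G‖ ^ 2) + (‖b‖ ^ 2 + ‖H‖ ^ 2) := by
    nlinarith [sq_nonneg (‖G‖ - ‖H‖), sq_nonneg ‖a‖, sq_nonneg ‖b‖, sq_nonneg ‖G‖, sq_nonneg ‖H‖]
  have h2 : ‖a‖ * ‖b‖ ≤ (‖a‖ ^ 2 + ‖G‖ ^ 2) + (‖b‖ ^ 2 + ‖H‖ ^ 2) := by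
    nlinarith [sq_nonneg (‖a‖ - ‖b‖), sq_nonneg ‖a‖, sq_nonneg ‖b‖, sq_nonneg ‖G‖, sq_nonneg ‖H‖]
  have hS : 0 ≤ ∑ j, ‖curlCLM j‖ ^ 2 := Finset.sum_nonneg fun j _ => sq_nonneg _
  refine h0.trans ?_
  simp only at h1 h2 ⊢
  generalize (‖a‖ ^ 2 + ‖G‖ ^ 2) + (‖b‖ ^ 2 + ‖H‖ ^ 2) = X at *
  calc _ ≤ 2 * |mu| * X + |lam| * (‖divCLM‖ ^ 2 * X) +
      |mu| * ((∑ j, ‖curlCLM j‖ ^ 2) * X) + ω ^ 2 * X := by gcongr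
    _ = volumeConst lam mu ω * X := by rw [volumeConst]; ring

theorem integrable_norm_sq_fn (u : energySpace D h) :
    Integrable (fun x => ‖fn u x‖ ^ 2 + ‖grad u x‖ ^ 2) (volume.restrict (strip D h)) ∧
      ∫ x in strip D h, (‖fn u x‖ ^ 2 + ‖grad u x‖ ^ 2) = ‖u‖ ^ 2 := by
  have h1 : Integrable (fun x => ‖fn u x‖ ^ 2) (volume.restrict (strip D h)) :=
    (Lp.memLp (fnL2 D h u)).integrable_norm_pow two_ne_zero
  have h2 : Integrable (fun x => ‖grad u x‖ ^ 2) (volume.restrict (strip D h)) :=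
    (Lp.memLp (gradL2 D h u)).integrable_norm_pow two_ne_zero
  refine ⟨h1.add h2, ?_⟩
  rw [integral_add h1 h2, norm_sq_energySpace, Lp_norm_sq, Lp_norm_sq]
  rfl

theorem volume_bound (u v : energySpace D h) :
    Integrable (fun x => volumeSesq lam mu ω (fn v x, grad v x) (fn u x, grad u x))
        (volume.restrict (strip D h)) ∧
      ‖∫ x in strip D h, volumeSesq lam mu ω (fn v x, grad v x) (fn u x, grad u x)‖ ≤
        volumeConst lam mu ω * (‖u‖ ^ 2 + ‖v‖ ^ 2) := by
  obtain ⟨hu, hu'⟩ := integrable_norm_sq_fn u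
  obtain ⟨hv, hv'⟩ := integrable_norm_sq_fn v
  have hp : ∀ u : energySpace D h, AEStronglyMeasurable (fun x => (fn u x, grad u x))
      (volume.restrict (strip D h)) := fun u =>
    (Lp.aestronglyMeasurable (fnL2 D h u)).prodMk (Lp.aestronglyMeasurable (gradL2 D h u))
  have hmeas : AEStronglyMeasurable
      (fun x => volumeSesq lam mu ω (fn v x, grad v x) (fn u x, grad u x))
      (volume.restrict (strip D h)) := by
    simpa only [Function.comp_def] using (continuous_volumeSesq (lam := lam) (mu := mu)
      (ω := ω)).comp_aestronglyMeasurable ((hp v).prodMk (hp u))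
  have hb : Integrable (fun x => volumeConst lam mu ω * ((‖fn u x‖ ^ 2 + ‖grad u x‖ ^ 2) +
      (‖fn v x‖ ^ 2 + ‖grad v x‖ ^ 2))) (volume.restrict (strip D h)) := (hu.add hv).const_mul _
  have hle : ∀ᵐ x ∂(volume.restrict (strip D h)),
      ‖volumeSesq lam mu ω (fn v x, grad v x) (fn u x, grad u x)‖ ≤ volumeConst lam mu ω *
        ((‖fn u x‖ ^ 2 + ‖grad u x‖ ^ 2) + (‖fn v x‖ ^ 2 + ‖grad v x‖ ^ 2)) :=
    Filter.Eventually.of_forall fun x =>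
      norm_volumeSesq_le (fn v x, grad v x) (fn u x, grad u x)
  refine ⟨hb.mono' hmeas hle, (norm_integral_le_of_norm_le hb hle).trans_eq ?_⟩
  rw [integral_const_mul, integral_add hu hv, hu', hv']

theorem measurable_vertical (k : ℝ) : Measurable (vertical k) := by
  unfold vertical
  refine Measurable.ite (measurableSet_lt measurable_norm measurable_const) ?_ ?_ <;> fun_prop

theorem measurable_dtnMatrix (i j : Fin 3) : Measurable fun ξ => dtnMatrix lam mu ω ξ i j := by
  have h1 := measurable_vertical (kp lam mu ω)
  have h2 := measurable_vertical (ks mu ω)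
  simp only [dtnMatrix, Matrix.smul_apply, smul_eq_mul]
  fin_cases i <;> fin_cases j <;> simp <;> fun_prop

theorem aestronglyMeasurable_symbolForm {a b : R2 → C3} (ha : AEStronglyMeasurable a volume)
    (hb : AEStronglyMeasurable b volume) :
    AEStronglyMeasurable (fun ξ => symbolForm lam mu ω ξ (a ξ) (b ξ)) volume := by
  have hc : ∀ {a : R2 → C3}, AEStronglyMeasurable a volume → ∀ i,
      AEStronglyMeasurable (fun ξ => a ξ i) volume := fun ha i =>
    (EuclideanSpace.proj (𝕜 := ℂ) i : C3 →L[ℂ] ℂ).continuous.comp_aestronglyMeasurable ha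
  simp only [symbolForm, Pi.smul_apply, Matrix.mulVec, dotProduct, smul_eq_mul]
  refine Finset.aestronglyMeasurable_fun_sum _ fun i _ => ?_
  refine ((Finset.aestronglyMeasurable_fun_sum _ fun j _ => ?_).const_mul _).mul
    (Complex.continuous_conj.comp_aestronglyMeasurable (hc hb i))
  exact (measurable_dtnMatrix i j).aestronglyMeasurable.mul (hc ha j)

/-- The weighted norm controlling the boundary part of `B`. -/
theorem integral_weight_hat_trace_le (hD : (D : Set R3) ⊆ upperHalf m) (hmh : m ≤ h) {k : ℝ}
    (hk : 0 ≤ k) (u : energySpace D h) :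
    Integrable (fun ξ => (k + ‖ξ‖) * ‖hat (trace D h u) ξ‖ ^ 2) ∧
      ∫ ξ, (k + ‖ξ‖) * ‖hat (trace D h u) ξ‖ ^ 2 ≤ (k * (h - m) + 1) * ‖u‖ ^ 2 := by
  obtain ⟨h1, h1'⟩ := integral_norm_mul_hat_trace_le hD hmh u
  obtain ⟨h2, h2'⟩ := hat_norm_sq (trace D h u)
  have h3 := norm_sq_trace_le hD hmh u
  have hG : ‖gradL2 D h u‖ ^ 2 ≤ ‖u‖ ^ 2 := by
    rw [norm_sq_energySpace]
    exact le_add_of_nonneg_left (sq_nonneg _)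
  simp only [add_mul]
  refine ⟨(h2.const_mul k).add h1, ?_⟩
  rw [integral_add (h2.const_mul k) h1, integral_const_mul, h2', one_mul]
  have h0 : 0 ≤ h - m := by linarith
  have h4 : k * ‖trace D h u‖ ^ 2 ≤ k * ((h - m) * ‖u‖ ^ 2) := by
    gcongr
    exact h3.trans (by gcongr)
  linarith

/-- The order-one growth of the symbol is matched by the weight `k_s + |ξ|`, for which traces are
square integrable. The same pointwise bound gives absolute convergence and boundedness. -/
theorem dtn_bound (hD : (D : Set R3) ⊆ upperHalf m) (hmh : m ≤ h) (hmu : 0 < mu)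
    (hlam : 0 < lam + mu) (hω : 0 < ω) (u v : energySpace D h) :
    Integrable (dtnDensity lam mu ω u v) ∧
      ‖dtnPairing lam mu ω u v‖ ≤ 9 * symbolConst lam mu * (ks mu ω * (h - m) + 1) *
        (‖u‖ ^ 2 + ‖v‖ ^ 2) := by
  have hks := (ks_pos hmu hω).le
  obtain ⟨hu, hu'⟩ := integral_weight_hat_trace_le hD hmh hks u
  obtain ⟨hv, hv'⟩ := integral_weight_hat_trace_le hD hmh hks v
  have hC : 0 ≤ symbolConst lam mu := by unfold symbolConst; linarith
  have hmeas : AEStronglyMeasurable (dtnDensity lam mu ω u v) volume :=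
    aestronglyMeasurable_symbolForm (aestronglyMeasurable_hat _) (aestronglyMeasurable_hat _)
  have hb := (hu.add hv).const_mul (9 * symbolConst lam mu)
  have hle : ∀ ξ, ‖dtnDensity lam mu ω u v ξ‖ ≤ 9 * symbolConst lam mu *
      ((ks mu ω + ‖ξ‖) * ‖hat (trace D h u) ξ‖ ^ 2 +
        (ks mu ω + ‖ξ‖) * ‖hat (trace D h v) ξ‖ ^ 2) := by
    intro ξ
    refine (norm_symbolForm_le hmu hlam hω ξ _ _).trans ?_
    rw [mul_assoc (9 * symbolConst lam mu), ← mul_add]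
    gcongr
    nlinarith [sq_nonneg (‖hat (trace D h u) ξ‖ - ‖hat (trace D h v) ξ‖),
      sq_nonneg ‖hat (trace D h u) ξ‖, sq_nonneg ‖hat (trace D h v) ξ‖]
  refine ⟨hb.mono' hmeas (Filter.Eventually.of_forall hle), ?_⟩
  refine (norm_integral_le_of_norm_le hb (Filter.Eventually.of_forall hle)).trans ?_
  simp only [Pi.add_apply]
  rw [integral_const_mul, integral_add hu hv, mul_assoc (9 * symbolConst lam mu), mul_add (_ + 1)]
  gcongr

/-- The form `B` as a bundled sesquilinear form. -/
def sesqB (hD : (D : Set R3) ⊆ upperHalf m) (hmh : m ≤ h) (hmu : 0 < mu)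
    (hlam : 0 < lam + mu) (hω : 0 < ω) : energySpace D h →ₗ⋆[ℂ] energySpace D h →ₗ[ℂ] ℂ :=
  integralForm (volume.restrict (strip D h)) (fun u x => (fn u x, grad u x))
      (fun _ => volumeSesq lam mu ω)
      (fun u v => by
        filter_upwards [fn_add u v, grad_add u v] with x h1 h2
        simp [h1, h2])
      (fun c u => by
        filter_upwards [fn_smul c u, grad_smul c u] with x h1 h2
        simp [h1, h2])
      (fun u v => (volume_bound u v).1) -
    integralForm volume (fun u => hat (trace D h u)) (symbolSesq lam mu ω)
      (fun u v => by rw [map_add]; exact hat_add _ _)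
      (fun c u => by rw [map_smul]; exact hat_smul _ _)
      (fun u v => (dtn_bound hD hmh hmu hlam hω u v).1)

/-- The arguments are exchanged because the bundled form is conjugate linear in its first slot. -/
theorem sesqB_apply (hD : (D : Set R3) ⊆ upperHalf m) (hmh : m ≤ h) (hmu : 0 < mu)
    (hlam : 0 < lam + mu) (hω : 0 < ω) (u v : energySpace D h) :
    sesqB hD hmh hmu hlam hω v u = formB lam mu ω u v := rfl

theorem norm_formB_le (hD : (D : Set R3) ⊆ upperHalf m) (hmh : m ≤ h) (hmu : 0 < mu)
    (hlam : 0 < lam + mu) (hω : 0 < ω) (u v : energySpace D h) :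
    ‖formB lam mu ω u v‖ ≤ (volumeConst lam mu ω +
      9 * symbolConst lam mu * (ks mu ω * (h - m) + 1)) * (‖u‖ ^ 2 + ‖v‖ ^ 2) := by
  rw [add_mul]
  exact (norm_sub_le _ _).trans
    (add_le_add (volume_bound u v).2 (dtn_bound hD hmh hmu hlam hω u v).2)

end form

/-! ### Coercivity and unique solvability. -/

section coercivity

variable {D : Opens R3} {m h : ℝ} {lam mu ω : ℝ}

theorem re_volumeSesq_self_ge (hlam : 0 < lam + mu) (a : C3) (G : GradMat) :
    mu * ‖G‖ ^ 2 + mu * nullLagrangian G - ω ^ 2 * ‖a‖ ^ 2 ≤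
      (volumeSesq lam mu ω (a, G) (a, G)).re := by
  have ha : ω ^ 2 * ∑ j, a j * conj (a j) = ((ω ^ 2 * ‖a‖ ^ 2 : ℝ) : ℂ) := by
    rw [EuclideanSpace.norm_sq_eq]
    simp only [Complex.mul_conj, Complex.normSq_eq_norm_sq]
    push_cast
    rfl
  rw [volumeSesq, LinearMap.mk₂'ₛₗ_apply, Complex.sub_re, re_energyDensity_self, ha,
    Complex.ofReal_re]
  have := mul_nonneg hlam.le (sq_nonneg ‖divG G‖)
  linarith

theorem re_volume_test_ge (hD : (D : Set R3) ⊆ upperHalf m) (hmh : m ≤ h)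
    (hlam : 0 < lam + mu) (φ : 𝓓(D, C3)) {u : energySpace D h} (hu : u = testToEnergy D h φ) :
    mu * ‖gradL2 D h u‖ ^ 2 + mu * (∫ ξ, nullForm ξ (planarFourier (slice φ h) ξ)) -
      ω ^ 2 * ‖fnL2 D h u‖ ^ 2 ≤
      (∫ x in strip D h, volumeSesq lam mu ω (fn u x, grad u x) (fn u x, grad u x)).re := by
  have hgc : Continuous (gradAt φ) := continuous_gradAt φ
  have hgs := hasCompactSupport_gradAt φ
  have hG : Integrable (fun x => ‖gradAt φ x‖ ^ 2) (volume.restrict (strip D h)) :=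
    (memLp_gradAt φ _).integrable_norm_pow two_ne_zero
  have hF : Integrable (fun x => ‖φ x‖ ^ 2) (volume.restrict (strip D h)) :=
    (memLp_test φ _).integrable_norm_pow two_ne_zero
  have hnull : nullLagrangian 0 = 0 := by
    simp [nullLagrangian, ← divCLM_apply, ← curlCLM_apply]
  have hN : Integrable (fun x => nullLagrangian (gradAt φ x)) (volume.restrict (strip D h)) := by
    refine (integral_nullLagrangian hG ?_ fun j => ?_).1
    · exact ((Continuous.integrable_of_hasCompactSupport (by fun_prop)
        (hgs.comp_left (g := fun G => ‖divCLM G‖ ^ 2) (by simp)))).integrableOn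
    · exact ((Continuous.integrable_of_hasCompactSupport (by fun_prop)
        (hgs.comp_left (g := fun G => ‖curlCLM j G‖ ^ 2) (by simp)))).integrableOn
  have e1 : ‖gradL2 D h u‖ ^ 2 = ∫ x in strip D h, ‖gradAt φ x‖ ^ 2 := by
    rw [hu]; exact norm_sq_toLp (memLp_gradAt φ (strip D h))
  have e2 : ‖fnL2 D h u‖ ^ 2 = ∫ x in strip D h, ‖φ x‖ ^ 2 := by
    rw [hu]; exact norm_sq_toLp (memLp_test φ (strip D h))
  have e3 : ∫ ξ, nullForm ξ (planarFourier (slice φ h) ξ) =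
      ∫ x in strip D h, nullLagrangian (gradAt φ x) := by
    rw [setIntegral_strip_eq_slab hD fun x hx => by rw [gradAt_test_eq_zero φ hx, hnull]]
    exact ((nullLagrangian_slab φ.contDiff φ.hasCompactSupport hmh
      (test_eq_zero_of_bottom hD φ)).2).symm
  have hre : (∫ x in strip D h, volumeSesq lam mu ω (fn u x, grad u x) (fn u x, grad u x)).re =
      ∫ x in strip D h, (volumeSesq lam mu ω (fn u x, grad u x) (fn u x, grad u x)).re :=
    (integral_re (volume_bound u u).1).symm
  have hA : Integrable (fun x => mu * ‖gradAt φ x‖ ^ 2 + mu * nullLagrangian (gradAt φ x))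
      (volume.restrict (strip D h)) := (hG.const_mul _).add (hN.const_mul _)
  rw [hre, e1, e2, e3, ← integral_const_mul, ← integral_const_mul, ← integral_const_mul,
    ← integral_add (hG.const_mul _) (hN.const_mul _), ← integral_sub hA (hF.const_mul _)]
  refine integral_mono_ae (hA.sub (hF.const_mul _)) (volume_bound u u).1.re ?_
  filter_upwards [fn_testToEnergy (h := h) φ, grad_testToEnergy (h := h) φ] with x h1 h2
  rw [hu, h1, h2]
  exact re_volumeSesq_self_ge hlam _ _

theorem re_dtnPairing_test_le (hD : (D : Set R3) ⊆ upperHalf m) (hmh : m ≤ h) (hmu : 0 < mu)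
    (hlam : 0 < lam + mu) (hω : 0 < ω) (φ : 𝓓(D, C3)) {u : energySpace D h}
    (hu : u = testToEnergy D h φ) :
    (dtnPairing lam mu ω u u).re ≤ mu * (∫ ξ, nullForm ξ (planarFourier (slice φ h) ξ)) +
      lowFreqConst lam mu * ω * ‖trace D h u‖ ^ 2 := by
  have hint := (dtn_bound hD hmh hmu hlam hω u u).1
  have hnull := (nullLagrangian_slab φ.contDiff φ.hasCompactSupport hmh
    (test_eq_zero_of_bottom hD φ)).1
  obtain ⟨h2, h2'⟩ := hat_norm_sq (trace D h u)
  have hre : (dtnPairing lam mu ω u u).re = ∫ ξ, (dtnDensity lam mu ω u u ξ).re :=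
    (integral_re hint).symm
  rw [hre, ← h2', ← integral_const_mul, ← integral_const_mul,
    ← integral_add (hnull.const_mul _) (h2.const_mul _)]
  refine integral_mono_ae hint.re ((hnull.const_mul _).add (h2.const_mul _)) ?_
  have hhat : hat (trace D h u) =ᵐ[volume] planarFourier (slice φ h) := by
    rw [hu, trace_testToEnergy hD hmh]
    exact hat_testTrace h φ
  filter_upwards [hhat] with ξ hξ
  rw [← hξ]
  exact re_symbolForm_le hmu hlam hω ξ _

/-- The null-form integral bounds the volume term from below and the pairing from above with the
same coefficient `μ`, so it drops out. What is lost is controlled by the Poincaré and trace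
inequalities. -/
theorem re_formB_test_ge (hD : (D : Set R3) ⊆ upperHalf m) (hmh : m ≤ h) (hmu : 0 < mu)
    (hlam : 0 < lam + mu) (hω : 0 < ω) (φ : 𝓓(D, C3)) :
    (mu - ω ^ 2 * (h - m) ^ 2 - lowFreqConst lam mu * ω * (h - m)) *
      ‖gradL2 D h (testToEnergy D h φ)‖ ^ 2 ≤
        (formB lam mu ω (testToEnergy D h φ) (testToEnergy D h φ)).re := by
  have h1 := re_volume_test_ge (ω := ω) hD hmh hlam φ rfl
  have h2 := re_dtnPairing_test_le hD hmh hmu hlam hω φ rfl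
  have h3 := mul_le_mul_of_nonneg_left (norm_sq_fnL2_le hD hmh (testToEnergy D h φ)) (sq_nonneg ω)
  have hC : 0 ≤ lowFreqConst lam mu * ω := by
    unfold lowFreqConst symbolConst
    have : 0 < 18 * (2 * mu + 2 * (lam + 2 * mu)) + 4 * mu := by linarith
    positivity
  have h4 := mul_le_mul_of_nonneg_left (norm_sq_trace_le hD hmh (testToEnergy D h φ)) hC
  have e : (formB lam mu ω (testToEnergy D h φ) (testToEnergy D h φ)).re =
      (∫ x in strip D h, volumeSesq lam mu ω
        (fn (testToEnergy D h φ) x, grad (testToEnergy D h φ) x)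
        (fn (testToEnergy D h φ) x, grad (testToEnergy D h φ) x)).re -
      (dtnPairing lam mu ω (testToEnergy D h φ) (testToEnergy D h φ)).re := Complex.sub_re _ _
  rw [e]
  linarith

/-- Coercivity of `B` at low frequencies. -/
theorem re_formB_ge (hD : (D : Set R3) ⊆ upperHalf m) (hmh : m ≤ h) (hmu : 0 < mu)
    (hlam : 0 < lam + mu) (hω : 0 < ω)
    (hsmall : ω ^ 2 * (h - m) ^ 2 + lowFreqConst lam mu * ω * (h - m) ≤ mu / 2)
    (u : energySpace D h) :
    mu / 2 / (1 + (h - m) ^ 2) * ‖u‖ ^ 2 ≤ (formB lam mu ω u u).re := by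
  -- Boundedness makes `B(u,u)` continuous, so the inequality passes from test functions to their
  -- closure.
  have hcont : Continuous fun u : energySpace D h => formB lam mu ω u u := by
    let B := (sesqB hD hmh hmu hlam hω).mkContinuous₂ _
      (norm_form_le_of_le_add (B := sesqB hD hmh hmu hlam hω)
        (norm_formB_le hD hmh hmu hlam hω))
    exact (B.continuous.clm_apply continuous_id : Continuous fun u => B u u)
  refine denseRange_testToEnergy.induction_on u
    (isClosed_le (by fun_prop) (Complex.continuous_re.comp hcont)) fun φ => ?_
  refine le_trans ?_ (re_formB_test_ge hD hmh hmu hlam hω φ)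
  -- Smallness leaves `μ/2` in front of `‖∇u‖²`, and Poincaré gives `‖u‖²_{H¹} ≤ (1 + (h-m)²)‖∇u‖²`.
  rw [norm_sq_energySpace, div_mul_eq_mul_div, div_le_iff₀ (by positivity)]
  have h1 := norm_sq_fnL2_le hD hmh (testToEnergy D h φ)
  have h2 : mu / 2 * ‖gradL2 D h (testToEnergy D h φ)‖ ^ 2 ≤
      (mu - ω ^ 2 * (h - m) ^ 2 - lowFreqConst lam mu * ω * (h - m)) *
        ‖gradL2 D h (testToEnergy D h φ)‖ ^ 2 := by
    gcongr
    linarith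
  have h3 := mul_le_mul_of_nonneg_right h2 (by positivity : 0 ≤ 1 + (h - m) ^ 2)
  nlinarith

theorem existsUnique_isVariationalSolution (hD : (D : Set R3) ⊆ upperHalf m) (hmh : m ≤ h)
    (hmu : 0 < mu) (hlam : 0 < lam + mu) (hω : 0 < ω)
    (hsmall : ω ^ 2 * (h - m) ^ 2 + lowFreqConst lam mu * ω * (h - m) ≤ mu / 2)
    (g : Lp C3 2 (volume.restrict (strip D h))) :
    ∃! u : energySpace D h, IsVariationalSolution lam mu ω g u := by
  -- The Riesz representative of the load is minus the adjoint of the inclusion into `L²` applied to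
  -- `g`.
  have hg : ∀ v : energySpace D h, inner ℂ v (-ContinuousLinearMap.adjoint (fnL2 D h) g) =
      -∫ x in strip D h, ∑ j, g x j * conj (fn v x j) := by
    intro v
    rw [inner_neg_right, ContinuousLinearMap.adjoint_inner_right, L2.inner_def]
    rfl
  have key := existsUnique_of_coercive (sesqB hD hmh hmu hlam hω)
    (norm_form_le_of_le_add (norm_formB_le hD hmh hmu hlam hω))
    (by positivity : 0 < mu / 2 / (1 + (h - m) ^ 2))
    (re_formB_ge hD hmh hmu hlam hω hsmall) (-ContinuousLinearMap.adjoint (fnL2 D h) g)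
  simp only [sesqB_apply, hg] at key
  exact key

end coercivity

end RoughElastic

end

theorem theorem3p2 (lam mu : ℝ) (hmu : 0 < mu) (hlam : 0 < lam + 2 * mu / 3)
    (m M L h : ℝ) (hmM : m < M) (hL : 0 < L) (hMh : M < h) :
    ∃ ω₀ : ℝ, 0 < ω₀ ∧
      ∀ (D : TopologicalSpace.Opens RoughElastic.R3) (f : RoughElastic.R2 → ℝ),
        RoughElastic.IsRoughDomain D f m M L →
        ∀ ω : ℝ, 0 < ω → ω ≤ ω₀ →
          (∀ u v : RoughElastic.energySpace D h,
            MeasureTheory.Integrable (RoughElastic.dtnDensity lam mu ω u v)) ∧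
          ∀ g : MeasureTheory.Lp RoughElastic.C3 2
              (MeasureTheory.volume.restrict (RoughElastic.strip D h)),
            ∃! u : RoughElastic.energySpace D h,
              RoughElastic.IsVariationalSolution lam mu ω g u := by
  have hlam' : 0 < lam + mu := by linarith
  have hmh : 0 < h - m := by linarith
  have hC : 0 ≤ RoughElastic.lowFreqConst lam mu := by
    unfold RoughElastic.lowFreqConst RoughElastic.symbolConst
    have : 0 < 18 * (2 * mu + 2 * (lam + 2 * mu)) + 4 * mu := by linarith
    positivity
  set A := (h - m) ^ 2 + RoughElastic.lowFreqConst lam mu * (h - m) with hA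
  have hApos : 0 < A := by positivity
  -- The cap at `1` gives `ω² ≤ ω`, which reduces the smallness condition to the linear one `ωA ≤
  -- μ/2`. `A` involves only `λ`, `μ` and `h - m`, so the threshold is chosen before `D` and `f`.
  refine ⟨min 1 (mu / 2 / A), by positivity, fun D f hDf ω hω hωle => ?_⟩
  have hω1 : ω ≤ 1 := hωle.trans (min_le_left _ _)
  have hω2 : ω * A ≤ mu / 2 := (le_div_iff₀ hApos).1 (hωle.trans (min_le_right _ _))
  have hsmall : ω ^ 2 * (h - m) ^ 2 + RoughElastic.lowFreqConst lam mu * ω * (h - m) ≤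
      mu / 2 := by
    have : ω ^ 2 * (h - m) ^ 2 ≤ ω * (h - m) ^ 2 := by
      gcongr
      nlinarith
    rw [hA] at hω2
    linarith
  exact ⟨fun u v => (RoughElastic.dtn_bound hDf.subset_upper (by linarith) hmu hlam' hω u v).1,
    RoughElastic.existsUnique_isVariationalSolution hDf.subset_upper (by linarith) hmu hlam' hω
      hsmall⟩
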